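/- Consider massless scalar QED at tree level with real coupling $g$ (three-point factor $-g(P+P')\cdot\epsilon$, four-point factor $-2g^2\epsilon\cdot\epsilon'$, propagators $1/P^2$), and one outgoing scalar leg $j$ attached to a hard vertex; the hard vertex and all other legs, to which no photons are attached, contribute the factor $1$. The final state contains the scalar of light-like momentum $p_j$, finitely many collinear photons $q_c$ ($c\in C$) and finitely many soft photons $k_s$ ($s\in S$), all real and light-like, with spinor-helicity polarization vectors $$\epsilon^-_q(r)=\sqrt2\,\frac{q\rangle[r}{[qr]},\qquad \epsilon^+_q(r)=\sqrt2\,\frac{r\rangle[q}{\langle rq\rangle}.$$ All momenta and reference vectors may depend on a parameter $\lambda\to0^+$ (the helicities are fixed). Let $n_j=(1,\vec u)$ with $|\vec u|=1$ be the jet direction, $\bar n_j=(1,-\vec u)$, and suppose: * $p_j$ and every $q_c$ have collinear scaling $(n_j\cdot q,\ \bar n_j\cdot q,\ q_\perp)\sim(\lambda^2,1,\lambda)$, with $\bar n_j\cdot q$ bounded away from $0$, and $p_j\cdot q_c\sim\lambda^2$ (bounded above and below by multiples of $\lambda^2$); * the reference vectors of the collinear photons are generic: $r_c=O(1)$ and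 $r_c\cdot q_c\sim1$ (bounded above and away from $0$); * every soft momentum satisfies $k_s^\mu=O(\lambda^2)$ and $n_j\cdot k_s\sim\lambda^2$ (bounded above and below; not collinear to leg $j$), its reference vector is not proportional to $k_s$, and $\epsilon_{k_s}=O(1)$. A diagram on leg $j$ attaches each photon to one vertex of the scalar line, each vertex carrying one or two photons. Let $T$ be any diagram on leg $j$ with the collinear photons only (a topology of self-collinear emissions), and let $D_T$ be its value. Let $w(T)$ be the sum over the vertices of $T$ of the number of different helicities among the photons at that vertex, so that power counting gives $D_T$ the order $\lambda^{-w(T)}$. Then, as $\lambda\to0^+$, $$\sum_{D\,:\,D|_C=T} D\;\cong\; D_T\times\langle X_s|Y_j^\dagger|0\rangle ,$$ where the sum runs over all diagrams $D$ on leg $j$ with all the collinear and all the soft photons which, when the soft photons are removed, have the collinear photons in the same order and sharing the same vertices as in $T$. Here $\langle X_s|Y_j^\dagger|0\rangle$ is the tree-level matrix element, between the soft photons $\langle X_s|$ and the vacuum, of the Wilson line $$Y_j^\dagger=\exp\Big(ig\int_0^\infty ds\,n_j\cdot A(s\,n_j)\,e^{-\varepsilon s}\Big)$$ in the limit $\varepsilon\to0^+$,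 which exists for all sufficiently small $\lambda>0$. The symbol $\cong$ (agreement at leading power) means that the right-hand side is $O(\lambda^{-w(T)-2|S|})$ and the difference of the two sides is $O(\lambda^{-w(T)-2|S|+1})$. -/

import Mathlib

open Filter Asymptotics Topology

noncomputable section

/-! ### Four-vectors, helicity spinors and polarization vectors -/

/-- Complexified four-vectors `V^μ`, `μ = 0, 1, 2, 3`. -/
abbrev FourVec : Type := Fin 4 → ℂ

/-- The (bilinear) Minkowski product with signature `(+,-,-,-)`. -/
def mdot (v w : FourVec) : ℂ := v 0 * w 0 - v 1 * w 1 - v 2 * w 2 - v 3 * w 3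

/-- Two-component spinors. A spinor `κ` stands for the pair `κ⟩ = κ`, `κ] = conj κ`
belonging to the real light-like momentum `κ⟩[κ`. -/
abbrev Spinor : Type := Fin 2 → ℂ

/-- The angle product `⟨κ ρ⟩`. -/
def ang (κ ρ : Spinor) : ℂ := κ 0 * ρ 1 - κ 1 * ρ 0

/-- The square product `[κ ρ]`, with `[κ ρ] = conj ⟨ρ κ⟩` for real momenta. -/
def sqr (κ ρ : Spinor) : ℂ := (starRingEnd ℂ) (ang ρ κ)

/-- The four-vector `V^μ = ½ tr(σ̄^μ M)` whose bispinor `M = σ_μ V^μ` (convention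
`M = [[V⁰+V³, V¹-iV²], [V¹+iV², V⁰-V³]]`) is `M = κ⟩[ρ`. -/
def bispinorVec (κ ρ : Spinor) : FourVec :=
  let M : Matrix (Fin 2) (Fin 2) ℂ := fun a b => κ a * (starRingEnd ℂ) (ρ b)
  ![(M 0 0 + M 1 1) / 2, (M 0 1 + M 1 0) / 2,
    Complex.I * (M 0 1 - M 1 0) / 2, (M 0 0 - M 1 1) / 2]

/-- The real light-like momentum with spinor `κ` (nonnegative energy). -/
def mom (κ : Spinor) : FourVec := bispinorVec κ κ

/-- The two photon helicities. -/
inductive Helicity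
  | plus
  | minus
  deriving DecidableEq

/-- The polarization vector of a photon with momentum spinor `κ` and reference spinor `ρ`:
`ε⁻ = √2 κ⟩[ρ / [κρ]` and `ε⁺ = √2 ρ⟩[κ / ⟨ρκ⟩`. -/
def polVec (h : Helicity) (κ ρ : Spinor) : FourVec :=
  match h with
  | .minus => ((Real.sqrt 2 : ℂ) / sqr κ ρ) • bispinorVec κ ρ
  | .plus => ((Real.sqrt 2 : ℂ) / ang ρ κ) • bispinorVec ρ κ

/-! ### Diagrams on one scalar leg -/

/-- A tree diagram of scalar QED in which the photons labelled by `α` are attached to one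
outgoing scalar leg. The vertices on the leg are numbered from the external end of the leg
towards the hard vertex, and `vertex a` is the vertex at which photon `a` is attached. Every
vertex carries one photon (three-point vertex) or two photons (four-point vertex). -/
structure LegDiagram (α : Type*) where
  numVertices : ℕ
  vertex : α → Fin numVertices
  surj : Function.Surjective vertex
  card_le_two : ∀ i, {a | vertex a = i}.ncard ≤ 2

instance LegDiagram.instFinite {α : Type*} [Finite α] : Finite (LegDiagram α) := by
  classical
  let F : LegDiagram α → Σ v : Fin (Nat.card α + 1), (α → Fin v) := fun D =>
    ⟨⟨D.numVertices, Nat.lt_succ_of_le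
      (by simpa using Nat.card_le_card_of_surjective D.vertex D.surj)⟩, D.vertex⟩
  refine Finite.of_injective F ?_
  rintro ⟨v, f, hf, hf'⟩ ⟨w, f', hw, hw'⟩ h
  simp only [F, Sigma.mk.injEq, Fin.mk.injEq] at h
  obtain ⟨rfl, h2⟩ := h
  simp_all

instance LegDiagram.instFintype {α : Type*} [Finite α] : Fintype (LegDiagram α) :=
  Fintype.ofFinite _

/-- The photons attached at vertex `i`. -/
def LegDiagram.photonsAt {α : Type*} [Fintype α] (D : LegDiagram α)
    (i : Fin D.numVertices) : Finset α := by
  classical exact {a | D.vertex a = i}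

/-- The scalar momentum on the hard side of vertex `i`: the external scalar momentum plus the
momenta of all photons emitted at vertices up to and including `i`. -/
def LegDiagram.momAfter {α : Type*} [Fintype α] (D : LegDiagram α) (p : FourVec)
    (k : α → FourVec) (i : Fin D.numVertices) : FourVec := by
  classical exact p + ∑ a with D.vertex a ≤ i, k a

/-- The scalar momentum on the external side of vertex `i`. -/
def LegDiagram.momBefore {α : Type*} [Fintype α] (D : LegDiagram α) (p : FourVec)
    (k : α → FourVec) (i : Fin D.numVertices) : FourVec := by
  classical exact p + ∑ a with D.vertex a < i, k a

/-- The vertex factor (including the `i` of the propagator next to it): `-g (P + P')·ε_a` for the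
three-point vertex, `-2 g² ε_a·ε_b` for the four-point vertex. In the second case the sum over
ordered pairs of distinct photons at the vertex has the two equal terms `(a,b)` and `(b,a)`. -/
def LegDiagram.vertexFactor {α : Type*} [Fintype α] (D : LegDiagram α) (g : ℝ) (p : FourVec)
    (k ε : α → FourVec) (i : Fin D.numVertices) : ℂ := by
  classical exact
    if (D.photonsAt i).card = 1 then
      ∑ a ∈ D.photonsAt i, -(g : ℂ) * mdot (D.momAfter p k i + D.momBefore p k i) (ε a)
    else
      ∑ ab ∈ (D.photonsAt i).offDiag, -(g : ℂ) ^ 2 * mdot (ε ab.1) (ε ab.2)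

/-- The value of the diagram: the product of all vertex factors and all (massless) scalar
propagators on the leg, including the propagator ending at the hard vertex. The hard vertex and
all legs without photons contribute the factor `1`. -/
def LegDiagram.amplitude {α : Type*} [Fintype α] (D : LegDiagram α) (g : ℝ) (p : FourVec)
    (k ε : α → FourVec) : ℂ :=
  ∏ i, D.vertexFactor g p k ε i / mdot (D.momAfter p k i) (D.momAfter p k i)

/-- `D`, a diagram with collinear photons `C` and soft photons `S`, has the collinear topology
`T`: upon removing the soft photons, the collinear photons are attached in the same order and
share vertices exactly as in `T`. -/
def LegDiagram.HasTopology {C S : Type*} (D : LegDiagram (C ⊕ S)) (T : LegDiagram C) : Prop :=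
  ∀ c c' : C, D.vertex (Sum.inl c) ≤ D.vertex (Sum.inl c') ↔ T.vertex c ≤ T.vertex c'

/-- The sum over all ways to attach the soft photons `S` to the leg, with the topology `T` of the
collinear photons held fixed. -/
def softAttachmentSum {C S : Type*} [Fintype C] [Fintype S] (T : LegDiagram C) (g : ℝ)
    (p : FourVec) (k ε : C ⊕ S → FourVec) : ℂ := by
  classical exact ∑ D : LegDiagram (C ⊕ S) with D.HasTopology T, D.amplitude g p k ε

/-! ### Matrix elements of the soft Wilson line -/

/-- The one-photon matrix element `⟨ε(k)| A^μ(x) |0⟩ = ε^μ e^{i k·x}`. -/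
def photonWave (k ε : FourVec) (x : FourVec) : FourVec :=
  Complex.exp (Complex.I * mdot k x) • ε

/-- The tree-level matrix element `⟨k_1 ⋯ k_ℓ| n·A(x_1) ⋯ n·A(x_m) |0⟩`: the sum over all complete
contractions of the fields with the external photons (zero unless `m = ℓ`). -/
def fieldElement {S : Type*} [Fintype S] (n : FourVec) (k ε : S → FourVec) {m : ℕ}
    (x : Fin m → FourVec) : ℂ := by
  classical exact ∑ e : Fin m ≃ S, ∏ i, mdot n (photonWave (k (e i)) (ε (e i)) (x i))

/-- The tree-level matrix element `⟨X_s| Y_n^†(0) |0⟩` in the state of the photons `S`, where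
`Y_n^†(0) = exp(i g ∫_0^∞ ds n·A(s n) e^{-δ s})`, from the exponential series. -/
def wilsonElement {S : Type*} [Fintype S] (g δ : ℝ) (n : FourVec) (k ε : S → FourVec) : ℂ :=
  ∑' m : ℕ, (Complex.I * g) ^ m / (m.factorial : ℂ) *
    ∫ s in Set.univ.pi (fun _ : Fin m => Set.Ioi (0 : ℝ)),
      fieldElement n k ε (fun i => (s i : ℂ) • n) * (Real.exp (-δ * ∑ i, s i) : ℂ)

/-! ### Soft and collinear kinematics -/

/-- The light-like vector `n = (1, u)`. -/
def lightVec (u : Fin 3 → ℝ) : FourVec := ![1, (u 0 : ℂ), (u 1 : ℂ), (u 2 : ℂ)]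

/-- `V_⊥ = V - ½ (n·V) n̄ - ½ (n̄·V) n` with `n = (1, u)`, `n̄ = (1, -u)`. -/
def perpPart (u : Fin 3 → ℝ) (v : FourVec) : FourVec :=
  v - (mdot (lightVec u) v / 2) • lightVec (-u) - (mdot (lightVec (-u)) v / 2) • lightVec u

/-- Families, depending on the power-counting parameter `l > 0`, of: the jet direction, the
spinor of the scalar `p_j`, the spinors of the collinear (`C`) and soft (`S`) photons, and the
reference spinors of their polarization vectors; together with the photon helicities. -/
structure LegKinematics (C S : Type*) where
  dir : ℝ → Fin 3 → ℝ
  scalar : ℝ → Spinor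
  photon : C ⊕ S → ℝ → Spinor
  ref : C ⊕ S → ℝ → Spinor
  hel : C ⊕ S → Helicity

namespace LegKinematics

variable {C S : Type*}

/-- The light-like jet direction `n_j`. -/
def n (K : LegKinematics C S) (l : ℝ) : FourVec := lightVec (K.dir l)

/-- The momentum of the outgoing scalar. -/
def p (K : LegKinematics C S) (l : ℝ) : FourVec := mom (K.scalar l)

/-- The photon momenta. -/
def k (K : LegKinematics C S) (l : ℝ) (a : C ⊕ S) : FourVec := mom (K.photon a l)

/-- The photon polarization vectors. -/
def pol (K : LegKinematics C S) (l : ℝ) (a : C ⊕ S) : FourVec :=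
  polVec (K.hel a) (K.photon a l) (K.ref a l)

/-- Collinear scaling `(V⁺, V⁻, V_⊥) ∼ (l², 1, l)` as `l → 0⁺` with respect to `n = (1, u)`; the
large component is really of order one. -/
def CollinearScaling (u : ℝ → Fin 3 → ℝ) (v : ℝ → FourVec) : Prop :=
  (fun l => mdot (lightVec (u l)) (v l)) =O[𝓝[>] 0] (fun l => l ^ 2) ∧
  (fun l => mdot (lightVec (-u l)) (v l)) =Θ[𝓝[>] 0] (fun _ => (1 : ℝ)) ∧
  (fun l => perpPart (u l) (v l)) =O[𝓝[>] 0] (fun l => l)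

/-- The kinematic region under consideration, as `l → 0⁺`. -/
structure InRegion (K : LegKinematics C S) : Prop where
  dir_unit : ∀ l, ∑ i, K.dir l i ^ 2 = 1
  scalar_collinear : CollinearScaling K.dir K.p
  photon_collinear : ∀ c : C, CollinearScaling K.dir (fun l => K.k l (Sum.inl c))
  /-- `q · p_j ∼ l²` for the collinear photons. -/
  dot_collinear : ∀ c : C,
    (fun l => mdot (K.p l) (K.k l (Sum.inl c))) =Θ[𝓝[>] 0] (fun l => l ^ 2)
  /-- Generic reference vectors for the collinear photons: `r ∼ 1` and `r · q ∼ 1`. -/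
  ref_collinear : ∀ c : C, (fun l => mom (K.ref (Sum.inl c) l)) =O[𝓝[>] 0] (fun _ => (1 : ℝ))
  ref_generic : ∀ c : C,
    (fun l => mdot (mom (K.ref (Sum.inl c) l)) (K.k l (Sum.inl c))) =Θ[𝓝[>] 0]
      (fun _ => (1 : ℝ))
  /-- All components of the soft momenta are of order `l²`. -/
  photon_soft : ∀ s : S, (fun l => K.k l (Sum.inr s)) =O[𝓝[>] 0] (fun l => l ^ 2)
  /-- The soft photons are not collinear to the jet. -/
  soft_not_collinear : ∀ s : S,
    (fun l => mdot (K.n l) (K.k l (Sum.inr s))) =Θ[𝓝[>] 0] (fun l => l ^ 2)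
  /-- The soft reference vectors are not proportional to the soft momenta, and the soft
  polarization vectors are not enhanced: `ε ∼ 1`. -/
  ref_soft : ∀ s : S, ∀ᶠ l in 𝓝[>] (0 : ℝ), ang (K.photon (Sum.inr s) l) (K.ref (Sum.inr s) l) ≠ 0
  pol_soft : ∀ s : S, (fun l => K.pol l (Sum.inr s)) =O[𝓝[>] 0] (fun _ => (1 : ℝ))

/-- The number `w` for which power counting gives the collinear diagram `T` the order `l^(-w)`:
the sum over the vertices of the number of different helicities at the vertex. A three-point
vertex with the next propagator gives `l / l²`. A four-point vertex with the next propagator gives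
`1 / l²` if the two helicities are opposite (`ε·ε' ∼ 1`) and `l / l²` if they are equal
(`ε·ε' ∼ l`). -/
def collinearOrder [Fintype C] (K : LegKinematics C S) (T : LegDiagram C) : ℕ :=
  ∑ i, ((T.photonsAt i).image (fun c => K.hel (Sum.inl c))).card

end LegKinematics

/-- `f` and `h` agree at leading power, the leading power being `l ^ a`: `h` is of order `l ^ a`,
and the two differ only by terms suppressed by a further power of `l`. -/
def AgreeAtLeadingPower (a : ℤ) (f h : ℝ → ℂ) : Prop :=
  h =O[𝓝[>] 0] (fun l : ℝ => l ^ a) ∧ (fun l => f l - h l) =O[𝓝[>] 0] (fun l : ℝ => l ^ (a + 1))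

end

/-!
Soft photons factor off a leg with collinear emissions because at leading power every soft emission
is eikonal. A collinear momentum `P` enters the products with soft vectors only through
`½ (n̄·P) n` (`IsCollinear.mdot_sub`), so a soft photon that sits alone at a vertex contributes
`-g (n̄·P)(n·ε)`, every propagator becomes the inverse of `P² + (n̄·P)(n·k)`, where `k` is the total
soft momentum emitted so far (`isOrder_inv_invariant_sub`), and the vertices of `T` keep their
collinear values (`isOrder_vertexFactor_sub_of_fiber`). Propagators are never smaller than `l²`,
because all the terms of `(p + ∑ k)²` are nonnegative (`norm_mdot_le_norm_sq`). A vertex that a soft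
photon shares with another photon loses a propagator and is suppressed (`isOrder_factor_of_ne`). The
power counting of the collinear vertices themselves follows from the spinor products:
`P·ε ∝ ⟨Pq⟩[Pr]` and, for equal helicities, `ε·ε' ∝ ⟨qq'⟩[rr']`, up to complex conjugation, are both
of order `l`.

What remains is a sum over the orders in which the soft photons can be inserted among the vertices
of `T`. After the factors `V_t / P_t²` of the vertices of `T` and `-g n·ε / n·k` of the soft photons
have been divided out, each term is a product of the ratios `lastWeight`: the term of the eikonal
denominator that belongs to the last label, divided by the whole denominator. As `p² = 0`, these
ratios add up to one over the labels that may come last (`sum_lastWeight`), like transition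
probabilities. The sum of their products over all the orders is therefore one
(`sum_equiv_prod_eq_one`, by induction on the last letter), and the soft emissions are independent
(`eventually_sum_prod_eikonalFactor`). The Wilson line gives the same product of one-photon factors
(`tendsto_wilsonElement`): only one term of the exponential series has the right number of fields,
and its integral is a product of integrals of exponentials.
-/

/-! ### Minkowski products of spinor momenta -/

lemma mdot_comm (v w : FourVec) : mdot v w = mdot w v := by simp only [mdot]; ring

lemma mdot_add_left (v v' w : FourVec) : mdot (v + v') w = mdot v w + mdot v' w := by
  simp only [mdot, Pi.add_apply]; ring

lemma mdot_add_right (v w w' : FourVec) : mdot v (w + w') = mdot v w + mdot v w' := by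
  simp only [mdot, Pi.add_apply]; ring

lemma mdot_smul_left (c : ℂ) (v w : FourVec) : mdot (c • v) w = c * mdot v w := by
  simp only [mdot, Pi.smul_apply, smul_eq_mul]; ring

lemma mdot_smul_right (c : ℂ) (v w : FourVec) : mdot v (c • w) = c * mdot v w := by
  simp only [mdot, Pi.smul_apply, smul_eq_mul]; ring

lemma mdot_zero_right (v : FourVec) : mdot v 0 = 0 := by simp [mdot]

lemma mdot_sum_left {ι : Type*} (A : Finset ι) (f : ι → FourVec) (w : FourVec) :
    mdot (∑ a ∈ A, f a) w = ∑ a ∈ A, mdot (f a) w := by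
  simp [mdot, Finset.sum_apply, Finset.sum_mul, Finset.sum_sub_distrib]

lemma mdot_sum_right {ι : Type*} (A : Finset ι) (f : ι → FourVec) (v : FourVec) :
    mdot v (∑ a ∈ A, f a) = ∑ a ∈ A, mdot v (f a) := by
  simp [mdot, Finset.sum_apply, Finset.mul_sum, Finset.sum_sub_distrib]

lemma norm_mdot_le (v w : FourVec) : ‖mdot v w‖ ≤ 4 * (‖v‖ * ‖w‖) := by
  have h : ∀ i, ‖v i * w i‖ ≤ ‖v‖ * ‖w‖ := fun i => by
    rw [norm_mul]
    exact mul_le_mul (norm_le_pi_norm v i) (norm_le_pi_norm w i) (norm_nonneg _) (norm_nonneg _)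
  calc ‖mdot v w‖ ≤ ‖v 0 * w 0‖ + ‖v 1 * w 1‖ + ‖v 2 * w 2‖ + ‖v 3 * w 3‖ := by
        unfold mdot
        refine (norm_sub_le _ _).trans (add_le_add_left ((norm_sub_le _ _).trans
          (add_le_add_left (norm_sub_le _ _) _)) _)
    _ ≤ _ := by linarith [h 0, h 1, h 2, h 3]

/-- The Minkowski product of two bispinors: `2 (κ⟩[ρ)·(κ'⟩[ρ') = ⟨κκ'⟩[ρ'ρ]`. -/
lemma mdot_bispinorVec (κ ρ κ' ρ' : Spinor) :
    mdot (bispinorVec κ ρ) (bispinorVec κ' ρ') =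
      ang κ κ' * (starRingEnd ℂ) (ang ρ ρ') / 2 := by
  simp only [mdot, bispinorVec, ang, map_sub, map_mul, Matrix.cons_val_zero, Matrix.cons_val_one,
    Matrix.cons_val]
  linear_combination (-(κ 0 * (starRingEnd ℂ) (ρ 1) - κ 1 * (starRingEnd ℂ) (ρ 0)) *
    (κ' 0 * (starRingEnd ℂ) (ρ' 1) - κ' 1 * (starRingEnd ℂ) (ρ' 0)) / 4) * Complex.I_sq

lemma mdot_mom (κ ρ : Spinor) : mdot (mom κ) (mom ρ) = ((‖ang κ ρ‖ ^ 2 / 2 : ℝ) : ℂ) := by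
  rw [mom, mom, mdot_bispinorVec, Complex.mul_conj, Complex.normSq_eq_norm_sq]
  push_cast; ring

lemma mdot_mom_self (κ : Spinor) : mdot (mom κ) (mom κ) = 0 := by
  rw [mdot_mom]; simp [ang, mul_comm]

lemma norm_ang_le (κ ρ : Spinor) : ‖ang κ ρ‖ ≤ 2 * (‖κ‖ * ‖ρ‖) := by
  have h : ∀ i j, ‖κ i * ρ j‖ ≤ ‖κ‖ * ‖ρ‖ := fun i j => by
    rw [norm_mul]
    exact mul_le_mul (norm_le_pi_norm κ i) (norm_le_pi_norm ρ j) (norm_nonneg _) (norm_nonneg _)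
  exact (norm_sub_le _ _).trans (by linarith [h 0 1, h 1 0])

lemma norm_bispinorVec_le (κ ρ : Spinor) : ‖bispinorVec κ ρ‖ ≤ ‖κ‖ * ‖ρ‖ := by
  have h : ∀ i j, ‖κ i * (starRingEnd ℂ) (ρ j)‖ ≤ ‖κ‖ * ‖ρ‖ := fun i j => by
    rw [norm_mul, RCLike.norm_conj]
    exact mul_le_mul (norm_le_pi_norm κ i) (norm_le_pi_norm ρ j) (norm_nonneg _) (norm_nonneg _)
  have h2 : ∀ x y : ℂ, ‖x‖ ≤ ‖κ‖ * ‖ρ‖ → ‖y‖ ≤ ‖κ‖ * ‖ρ‖ →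
      ‖(x + y) / 2‖ ≤ ‖κ‖ * ‖ρ‖ ∧ ‖(x - y) / 2‖ ≤ ‖κ‖ * ‖ρ‖ ∧
        ‖Complex.I * (x - y) / 2‖ ≤ ‖κ‖ * ‖ρ‖ := by
    intro x y hx hy
    have h1 := norm_add_le x y
    have h2 := norm_sub_le x y
    simp only [norm_div, norm_mul, Complex.norm_I, one_mul, Complex.norm_ofNat]
    refine ⟨?_, ?_, ?_⟩ <;> linarith
  rw [pi_norm_le_iff_of_nonneg (by positivity)]
  intro i
  fin_cases i
  · exact (h2 _ _ (h 0 0) (h 1 1)).1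
  · exact (h2 _ _ (h 0 1) (h 1 0)).1
  · exact (h2 _ _ (h 0 1) (h 1 0)).2.2
  · exact (h2 _ _ (h 0 0) (h 1 1)).2.1

/-- The size of a spinor is controlled by the energy of its momentum. -/
lemma norm_sq_le_norm_mom (κ : Spinor) : ‖κ‖ ^ 2 ≤ 2 * ‖mom κ‖ := by
  have h0 : mom κ 0 = (((‖κ 0‖ ^ 2 + ‖κ 1‖ ^ 2) / 2 : ℝ) : ℂ) := by
    simp only [mom, bispinorVec, Matrix.cons_val_zero, Complex.mul_conj,
      Complex.normSq_eq_norm_sq]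
    push_cast; ring
  have h1 : (‖κ 0‖ ^ 2 + ‖κ 1‖ ^ 2) / 2 ≤ ‖mom κ‖ := by
    have := norm_le_pi_norm (mom κ) 0
    rwa [h0, Complex.norm_of_nonneg (by positivity)] at this
  have h2 : ‖κ‖ ≤ Real.sqrt (2 * ‖mom κ‖) := by
    rw [pi_norm_le_iff_of_nonneg (Real.sqrt_nonneg _)]
    intro i
    refine Real.le_sqrt_of_sq_le ?_
    fin_cases i
    · simp only [Fin.zero_eta]; nlinarith [sq_nonneg ‖κ 1‖]
    · simp only [Fin.mk_one]; nlinarith [sq_nonneg ‖κ 0‖]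
  calc ‖κ‖ ^ 2 ≤ Real.sqrt (2 * ‖mom κ‖) ^ 2 := by gcongr
    _ = 2 * ‖mom κ‖ := Real.sq_sqrt (by positivity)

/-! ### Light-cone decomposition -/

/-- The momentum of a spinor is real and light-like, with nonnegative energy. -/
lemma exists_real_mom (κ : Spinor) : ∃ v : Fin 4 → ℝ, (∀ i, mom κ i = (v i : ℂ)) ∧ 0 ≤ v 0 ∧
    v 0 ^ 2 = v 1 ^ 2 + v 2 ^ 2 + v 3 ^ 2 := by
  refine ⟨![((κ 0).re ^ 2 + (κ 0).im ^ 2 + (κ 1).re ^ 2 + (κ 1).im ^ 2) / 2,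
    (κ 0).re * (κ 1).re + (κ 0).im * (κ 1).im, (κ 0).re * (κ 1).im - (κ 0).im * (κ 1).re,
    ((κ 0).re ^ 2 + (κ 0).im ^ 2 - (κ 1).re ^ 2 - (κ 1).im ^ 2) / 2], ?_, ?_, ?_⟩
  · intro i
    fin_cases i <;> apply Complex.ext <;>
      simp [mom, bispinorVec, pow_two] <;> ring
  · simp only [Matrix.cons_val_zero]; positivity
  · simp only [Matrix.cons_val_zero, Matrix.cons_val_one, Matrix.cons_val]; ring

lemma mdot_lightVec_mom (u : Fin 3 → ℝ) (hu : ∑ i, u i ^ 2 = 1) (κ : Spinor) :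
    ∃ x : ℝ, 0 ≤ x ∧ mdot (lightVec u) (mom κ) = x := by
  obtain ⟨v, hv, h0, hsq⟩ := exists_real_mom κ
  rw [Fin.sum_univ_three] at hu
  refine ⟨v 0 - u 0 * v 1 - u 1 * v 2 - u 2 * v 3, ?_, ?_⟩
  · have : (u 0 * v 1 + u 1 * v 2 + u 2 * v 3) ^ 2 ≤ v 0 ^ 2 := by
      have e : v 0 ^ 2 = (u 0 ^ 2 + u 1 ^ 2 + u 2 ^ 2) * (v 1 ^ 2 + v 2 ^ 2 + v 3 ^ 2) := by
        rw [hu, one_mul, hsq]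
      rw [e]
      nlinarith [sq_nonneg (u 0 * v 2 - u 1 * v 1), sq_nonneg (u 0 * v 3 - u 2 * v 1),
        sq_nonneg (u 1 * v 3 - u 2 * v 2)]
    have := abs_le_of_sq_le_sq this h0
    linarith [(abs_le.mp this).2]
  · simp [mdot, lightVec, hv]

lemma sum_neg_sq (u : Fin 3 → ℝ) (hu : ∑ i, u i ^ 2 = 1) : ∑ i, (-u) i ^ 2 = 1 := by
  simpa using hu

lemma norm_lightVec_le (u : Fin 3 → ℝ) (hu : ∑ i, u i ^ 2 = 1) : ‖lightVec u‖ ≤ 1 := by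
  rw [Fin.sum_univ_three] at hu
  rw [pi_norm_le_iff_of_nonneg zero_le_one]
  have h : ∀ i, |u i| ≤ 1 := fun i => by
    rw [← sq_le_one_iff_abs_le_one, ← hu, ← Fin.sum_univ_three (fun i => u i ^ 2)]
    exact Finset.single_le_sum (f := fun i => u i ^ 2) (fun i _ => sq_nonneg _) (Finset.mem_univ i)
  intro i
  fin_cases i <;> simp [lightVec, h]

/-- The Minkowski product in light-cone components. The transverse part of one of the vectors
suffices, because it is orthogonal to `n` and `n̄`. -/
lemma mdot_eq_lightCone (u : Fin 3 → ℝ) (v w : FourVec) :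
    mdot v w = mdot (lightVec (-u)) v / 2 * mdot (lightVec u) w +
      mdot (lightVec u) v / 2 * mdot (lightVec (-u)) w + mdot (perpPart u v) w := by
  simp only [perpPart, mdot, Pi.sub_apply, Pi.smul_apply, smul_eq_mul]
  ring

lemma mdot_lightVec_self (u : Fin 3 → ℝ) (hu : ∑ i, u i ^ 2 = 1) :
    mdot (lightVec u) (lightVec u) = 0 := by
  have h : ((u 0 : ℂ) ^ 2 + (u 1 : ℂ) ^ 2 + (u 2 : ℂ) ^ 2) = 1 := by
    rw [Fin.sum_univ_three] at hu; exact_mod_cast hu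
  simp only [mdot, lightVec, Matrix.cons_val_zero, Matrix.cons_val_one, Matrix.cons_val]
  linear_combination -h

lemma mdot_lightVec_neg (u : Fin 3 → ℝ) (hu : ∑ i, u i ^ 2 = 1) :
    mdot (lightVec u) (lightVec (-u)) = 2 := by
  have h : ((u 0 : ℂ) ^ 2 + (u 1 : ℂ) ^ 2 + (u 2 : ℂ) ^ 2) = 1 := by
    rw [Fin.sum_univ_three] at hu; exact_mod_cast hu
  simp only [mdot, lightVec, Matrix.cons_val_zero, Matrix.cons_val_one, Matrix.cons_val,
    Pi.neg_apply, Complex.ofReal_neg]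
  linear_combination h

lemma mdot_perpPart (u : Fin 3 → ℝ) (hu : ∑ i, u i ^ 2 = 1) (v w : FourVec) :
    mdot (perpPart u v) (perpPart u w) = mdot (perpPart u v) w := by
  have hself := mdot_lightVec_self u hu
  have hself' := mdot_lightVec_self (-u) (sum_neg_sq u hu)
  have hneg := mdot_lightVec_neg u hu
  have hl : ∀ x, mdot (perpPart u v) x = mdot v x + (-(mdot (lightVec u) v / 2) *
      mdot (lightVec (-u)) x + -(mdot (lightVec (-u)) v / 2) * mdot (lightVec u) x) := by
    intro x
    rw [← mdot_smul_left, ← mdot_smul_left, ← mdot_add_left, ← mdot_add_left]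
    congr 1
    simp only [perpPart, neg_smul]; abel
  have h1 : mdot (perpPart u v) (lightVec u) = 0 := by
    rw [hl, hself, mdot_comm (lightVec (-u)), hneg, mdot_comm v]; ring
  have h2 : mdot (perpPart u v) (lightVec (-u)) = 0 := by
    rw [hl, hself', hneg, mdot_comm v]; ring
  have e : perpPart u w = w + ((-(mdot (lightVec u) w / 2)) • lightVec (-u) +
      (-(mdot (lightVec (-u)) w / 2)) • lightVec u) := by
    simp only [perpPart, neg_smul]; abel
  rw [e, mdot_add_right, mdot_add_right, mdot_smul_right, mdot_smul_right, h1, h2]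
  ring

/-! ### Sums over linear extensions -/

section Words

variable {V : Type*} [DecidableEq V]

/-- The letters of the word `f` at the positions up to and including `i`. -/
def wordPrefix {n : ℕ} (f : Fin n → V) (i : Fin n) : Finset V :=
  (Finset.univ.filter (· ≤ i)).image f

/-- The word `f` lists the elements of `B` without repetition, in an order that extends the
relation `R`. -/
def IsExtension (R : V → V → Prop) (B : Finset V) {n : ℕ} (f : Fin n → V) : Prop :=
  Function.Injective f ∧ Finset.univ.image f = B ∧ ∀ i j, R (f i) (f j) → i < j

lemma wordPrefix_snoc_castSucc {n : ℕ} (f : Fin n → V) (v : V) (i : Fin n) :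
    wordPrefix (Fin.snoc f v : Fin (n + 1) → V) i.castSucc = wordPrefix f i := by
  ext w
  simp only [wordPrefix, Finset.mem_image, Finset.mem_filter, Finset.mem_univ, true_and]
  constructor
  · rintro ⟨j, hj, rfl⟩
    refine ⟨j.castLT (lt_of_le_of_lt hj i.castSucc_lt_last), ?_, ?_⟩
    · simpa [Fin.le_def] using hj
    · conv_rhs => rw [← Fin.castSucc_castLT j (lt_of_le_of_lt hj i.castSucc_lt_last)]
      rw [Fin.snoc_castSucc]
  · rintro ⟨j, hj, rfl⟩
    exact ⟨j.castSucc, by simpa using hj, by simp⟩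

lemma wordPrefix_last {n : ℕ} (f : Fin (n + 1) → V) :
    wordPrefix f (Fin.last n) = Finset.univ.image f := by
  simp [wordPrefix, Fin.le_last]

lemma image_snoc {n : ℕ} (f : Fin n → V) (v : V) :
    Finset.univ.image (Fin.snoc f v : Fin (n + 1) → V) = insert v (Finset.univ.image f) := by
  ext w
  simp only [Finset.mem_image, Finset.mem_univ, true_and, Finset.mem_insert, Fin.exists_fin_succ',
    Fin.snoc_castSucc, Fin.snoc_last]
  tauto

lemma isExtension_snoc_iff (R : V → V → Prop) (hR : ∀ v, ¬ R v v) (B : Finset V) {n : ℕ}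
    (f : Fin n → V) (v : V) :
    IsExtension R B (Fin.snoc f v : Fin (n + 1) → V) ↔
      (v ∈ B ∧ ∀ w ∈ B, ¬ R v w) ∧ IsExtension R (B.erase v) f := by
  unfold IsExtension
  rw [image_snoc]
  constructor
  · rintro ⟨h1, rfl, h3⟩
    have hv : v ∉ Finset.univ.image f := by
      simp only [Finset.mem_image, Finset.mem_univ, true_and, not_exists]
      intro i hi
      have := @h1 i.castSucc (Fin.last n) (by simpa using hi)
      exact absurd this i.castSucc_lt_last.ne
    refine ⟨⟨by simp, ?_⟩, ?_, ?_, ?_⟩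
    · intro w hw hvw
      rw [Finset.mem_insert] at hw
      rcases hw with rfl | hw
      · exact hR _ hvw
      · simp only [Finset.mem_image, Finset.mem_univ, true_and] at hw
        obtain ⟨i, rfl⟩ := hw
        have := h3 (Fin.last n) i.castSucc (by simpa using hvw)
        exact absurd this (Fin.le_last _).not_gt
    · intro i j hij
      simpa using @h1 i.castSucc j.castSucc (by simpa using hij)
    · rw [Finset.erase_insert hv]
    · intro i j hij
      simpa using h3 i.castSucc j.castSucc (by simpa using hij)
  · rintro ⟨⟨hv, hmax⟩, h1, h2, h3⟩
    have hmem : ∀ i, f i ∈ B.erase v := fun i => by rw [← h2]; simp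
    refine ⟨?_, ?_, ?_⟩
    · intro i j
      refine Fin.lastCases ?_ (fun i => ?_) i <;> refine Fin.lastCases ?_ (fun j => ?_) j
      · simp
      · intro h
        simp only [Fin.snoc_last, Fin.snoc_castSucc] at h
        exact absurd h.symm (Finset.ne_of_mem_erase (hmem j))
      · intro h
        simp only [Fin.snoc_last, Fin.snoc_castSucc] at h
        exact absurd h (Finset.ne_of_mem_erase (hmem i))
      · intro h
        simp only [Fin.snoc_castSucc] at h
        rw [h1 h]
    · rw [h2, Finset.insert_erase hv]
    · intro i j
      refine Fin.lastCases ?_ (fun i => ?_) i <;> refine Fin.lastCases ?_ (fun j => ?_) j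
      · intro h
        exact absurd h (by simpa using hR v)
      · intro h
        simp only [Fin.snoc_last, Fin.snoc_castSucc] at h
        exact absurd h (hmax _ (Finset.mem_of_mem_erase (hmem j)))
      · intro _
        exact i.castSucc_lt_last
      · intro h
        simp only [Fin.snoc_castSucc] at h
        simpa using h3 i j h

open Classical in
/-- If the numbers `c v B` are normalized weights for the choice of the last letter of a word on the
set `B`, the products of the weights along all the words on `B` sum to one. -/
theorem sum_extension_prod_eq_one [Fintype V] (R : V → V → Prop) (hR : ∀ v, ¬ R v v)
    (c : V → Finset V → ℂ)
    (hc : ∀ B : Finset V, B.Nonempty → ∑ v ∈ B with ∀ w ∈ B, ¬ R v w, c v B = 1)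
    (n : ℕ) (B : Finset V) (hB : B.card = n) :
    ∑ f : Fin n → V with IsExtension R B f, ∏ i, c (f i) (wordPrefix f i) = 1 := by
  induction n generalizing B with
  | zero =>
    have hB0 : B = ∅ := Finset.card_eq_zero.mp hB
    subst hB0
    have : ∀ f : Fin 0 → V, IsExtension R ∅ f := fun f =>
      ⟨Function.injective_of_subsingleton f, by simp, fun i => i.elim0⟩
    simp [this]
  | succ n ih =>
    have hne : B.Nonempty := Finset.card_pos.mp (by omega)
    rw [Finset.sum_filter, ← (Fin.snocEquiv (fun _ : Fin (n + 1) => V)).sum_comp,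
      Fintype.sum_prod_type]
    rw [← hc B hne, Finset.sum_filter, ← Finset.sum_subset (Finset.subset_univ B)]
    · refine Finset.sum_congr rfl fun v hv => ?_
      have key : ∀ f : Fin n → V,
          (if IsExtension R B (Fin.snocEquiv (fun _ : Fin (n + 1) => V) (v, f)) then
            ∏ i, c (Fin.snocEquiv (fun _ : Fin (n + 1) => V) (v, f) i)
              (wordPrefix (Fin.snocEquiv (fun _ : Fin (n + 1) => V) (v, f)) i) else 0) =
          if (∀ w ∈ B, ¬ R v w) then
            (if IsExtension R (B.erase v) f then
              (∏ i, c (f i) (wordPrefix f i)) * c v B else 0) else 0 := by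
        intro f
        have e : (Fin.snocEquiv (fun _ : Fin (n + 1) => V) (v, f)) =
            (Fin.snoc f v : Fin (n + 1) → V) := rfl
        rw [e, ← ite_and]
        by_cases h : IsExtension R B (Fin.snoc f v : Fin (n + 1) → V)
        · have h' := (isExtension_snoc_iff R hR B f v).mp h
          rw [if_pos h, if_pos ⟨h'.1.2, h'.2⟩, Fin.prod_univ_castSucc]
          simp only [Fin.snoc_castSucc, Fin.snoc_last, wordPrefix_snoc_castSucc, wordPrefix_last,
            h.2.1]
        · rw [if_neg h, if_neg]
          rintro ⟨h1, h2⟩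
          exact h ((isExtension_snoc_iff R hR B f v).mpr ⟨⟨hv, h1⟩, h2⟩)
      rw [Finset.sum_congr rfl fun f _ => key f]
      split_ifs with hmax
      · rw [← Finset.sum_filter, ← Finset.sum_mul, ih (B.erase v), one_mul]
        rw [Finset.card_erase_of_mem hv, hB]; rfl
      · simp
    · intro v _ hv
      refine Finset.sum_eq_zero fun f _ => if_neg fun h => hv ?_
      exact ((isExtension_snoc_iff R hR B f v).mp h).1.1

open Classical in
/-- The normalization of `sum_extension_prod_eq_one` for the whole type, with the words written as
enumerations `V ≃ Fin n`. -/
theorem sum_equiv_prod_eq_one [Fintype V] (R : V → V → Prop) (hR : ∀ v, ¬ R v v)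
    (c : V → Finset V → ℂ)
    (hc : ∀ B : Finset V, B.Nonempty → ∑ v ∈ B with ∀ w ∈ B, ¬ R v w, c v B = 1)
    (n : ℕ) (hn : Fintype.card V = n) :
    ∑ e : V ≃ Fin n with ∀ v w, R v w → e v < e w,
      ∏ v, c v (Finset.univ.filter fun w => e w ≤ e v) = 1 := by
  rw [← sum_extension_prod_eq_one R hR c hc n Finset.univ hn]
  refine Finset.sum_bij (fun e _ => ⇑e.symm) ?_ ?_ ?_ ?_
  · intro e he
    simp only [Finset.mem_filter, Finset.mem_univ, true_and] at he ⊢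
    refine ⟨e.symm.injective, ?_, fun i j h => by simpa using he _ _ h⟩
    exact Finset.image_univ_of_surjective e.symm.surjective
  · intro e _ e' _ h
    have := DFunLike.coe_injective h
    simpa using congrArg Equiv.symm this
  · intro f hf
    simp only [Finset.mem_filter, Finset.mem_univ, true_and] at hf
    obtain ⟨h1, h2, h3⟩ := hf
    have hs : Function.Surjective f := fun v => by
      have : v ∈ Finset.univ.image f := by rw [h2]; simp
      simpa using this
    refine ⟨(Equiv.ofBijective f ⟨h1, hs⟩).symm, ?_, rfl⟩
    simp only [Finset.mem_filter, Finset.mem_univ, true_and]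
    intro v w hvw
    obtain ⟨i, rfl⟩ := hs v
    obtain ⟨j, rfl⟩ := hs w
    have hi : ∀ i, (Equiv.ofBijective f ⟨h1, hs⟩).symm (f i) = i := fun i =>
      (Equiv.ofBijective f ⟨h1, hs⟩).symm_apply_apply i
    rw [hi, hi]
    exact h3 i j hvw
  · intro e _
    rw [← e.symm.prod_comp]
    refine Finset.prod_congr rfl fun i _ => ?_
    congr 1
    ext w
    simp only [wordPrefix, Finset.mem_filter, Finset.mem_univ, true_and, Finset.mem_image,
      Equiv.apply_symm_apply]
    constructor
    · intro h
      exact ⟨e w, h, by simp⟩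
    · rintro ⟨j, hj, rfl⟩
      simpa using hj

end Words

/-! ### The Wilson line matrix element -/

open MeasureTheory in
/-- At tree level only the `|S|`-th term of the exponential contributes, and its `|S|!` equal
contractions cancel the factorial: the photons are emitted independently of each other. -/
theorem wilsonElement_eq_prod {S : Type*} [Fintype S] (g δ : ℝ) (hδ : 0 < δ) (n : FourVec)
    (k ε : S → FourVec) (a : S → ℝ) (ha : ∀ s, mdot n (k s) = a s) :
    wilsonElement g δ n k ε =
      ∏ s, (Complex.I * g * mdot n (ε s) / (δ - Complex.I * a s)) := by
  classical
  -- `z s` is the exponent of the wave of photon `s` along `n`, with the convergence factor.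
  let z : S → ℂ := fun s => Complex.I * a s - δ
  have hz : ∀ s, (z s).re < 0 := fun s => by simp [z, hδ]
  have hint : ∀ s, Integrable (fun x : ℝ => mdot n (ε s) * Complex.exp (z s * x))
      (volume.restrict (Set.Ioi 0)) := fun s =>
    (integrableOn_exp_mul_complex_Ioi (hz s) 0).const_mul _
  have hval : ∀ s, ∫ x in Set.Ioi (0 : ℝ), mdot n (ε s) * Complex.exp (z s * x) =
      mdot n (ε s) / (δ - Complex.I * a s) := fun s => by
    rw [integral_const_mul, integral_exp_mul_complex_Ioi (hz s)]
    simp only [z, Complex.ofReal_zero, mul_zero, Complex.exp_zero]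
    rw [← neg_sub, div_neg, neg_div, neg_neg, mul_one_div]
  have hfun : ∀ (m : ℕ) (s : Fin m → ℝ),
      fieldElement n k ε (fun i => (s i : ℂ) • n) * (Real.exp (-δ * ∑ i, s i) : ℂ) =
        ∑ e : Fin m ≃ S, ∏ i, (mdot n (ε (e i)) * Complex.exp (z (e i) * s i)) := by
    intro m s
    unfold fieldElement
    rw [Finset.sum_mul]
    refine Finset.sum_congr (by ext; simp) fun e _ => ?_
    rw [Finset.mul_sum, Complex.ofReal_exp, Complex.ofReal_sum, Complex.exp_sum,
      ← Finset.prod_mul_distrib]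
    refine Finset.prod_congr rfl fun i _ => ?_
    rw [photonWave, mdot_smul_right, mdot_smul_right, mdot_comm (k (e i)), ha]
    rw [mul_comm (Complex.exp _), mul_assoc, ← Complex.exp_add]
    congr 2
    simp only [z]; push_cast; ring
  have hI : ∀ m : ℕ, ∫ s in Set.univ.pi (fun _ : Fin m => Set.Ioi (0 : ℝ)),
      fieldElement n k ε (fun i => (s i : ℂ) • n) * (Real.exp (-δ * ∑ i, s i) : ℂ) =
        (Fintype.card (Fin m ≃ S) : ℂ) * ∏ s, mdot n (ε s) / (δ - Complex.I * a s) := by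
    intro m
    simp only [hfun]
    rw [volume_pi, Measure.restrict_pi_pi, integral_finsetSum]
    · rw [Finset.sum_congr rfl (g := fun _ => ∏ s, mdot n (ε s) / (δ - Complex.I * a s))]
      · rw [Finset.sum_const, Finset.card_univ, nsmul_eq_mul]
      · intro e _
        rw [integral_fintype_prod_eq_prod
          (f := fun i (x : ℝ) => mdot n (ε (e i)) * Complex.exp (z (e i) * x))]
        simp only [hval]
        exact e.prod_comp (fun s => mdot n (ε s) / (δ - Complex.I * a s))
    · intro e _
      exact Integrable.fintype_prod fun i => hint (e i)
  unfold wilsonElement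
  simp only [hI]
  rw [tsum_eq_single (Fintype.card S)]
  · rw [Fintype.card_equiv (Fintype.equivFin S).symm, Fintype.card_fin]
    have hf : ((Fintype.card S).factorial : ℂ) ≠ 0 := by exact_mod_cast Nat.factorial_ne_zero _
    have : ∀ s, Complex.I * g * mdot n (ε s) / (δ - Complex.I * a s) =
        (Complex.I * g) * (mdot n (ε s) / (δ - Complex.I * a s)) := fun s => by ring
    simp only [this]
    rw [Finset.prod_mul_distrib, Finset.prod_const, Finset.card_univ]
    field_simp
  · -- There are no complete contractions if the numbers of fields and photons differ.
    intro m hm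
    have : IsEmpty (Fin m ≃ S) := ⟨fun e => hm (by simpa using Fintype.card_congr e)⟩
    simp

/-- The limit in which the convergence factor of the Wilson line is removed. -/
theorem tendsto_wilsonElement {S : Type*} [Fintype S] (g : ℝ) (n : FourVec)
    (k ε : S → FourVec) (a : S → ℝ) (ha : ∀ s, mdot n (k s) = a s) (h0 : ∀ s, a s ≠ 0) :
    Tendsto (fun δ : ℝ => wilsonElement g δ n k ε) (𝓝[>] 0)
      (𝓝 (∏ s, (-(g : ℂ) * mdot n (ε s) / mdot n (k s)))) := by
  have h : Tendsto (fun δ : ℝ => ∏ s, (Complex.I * g * mdot n (ε s) / (δ - Complex.I * a s)))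
      (𝓝[>] 0) (𝓝 (∏ s, (Complex.I * g * mdot n (ε s) / ((0 : ℝ) - Complex.I * a s)))) := by
    refine tendsto_finsetProd _ fun s _ => ?_
    refine Tendsto.div tendsto_const_nhds ?_ (by simp [h0 s])
    refine Tendsto.sub_const ?_ _
    exact (Complex.continuous_ofReal.tendsto 0).mono_left nhdsWithin_le_nhds
  have e : ∀ s, (-(g : ℂ) * mdot n (ε s) / mdot n (k s)) =
      Complex.I * g * mdot n (ε s) / ((0 : ℝ) - Complex.I * a s) := fun s => by
    have : (a s : ℂ) ≠ 0 := by exact_mod_cast h0 s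
    have hI := Complex.I_ne_zero
    rw [ha]; push_cast; field_simp; ring
  simp only [e]
  refine h.congr' ?_
  filter_upwards [self_mem_nhdsWithin] with δ hδ
  exact (wilsonElement_eq_prod g δ hδ n k ε a ha).symm

/-! ### Power counting -/

/-- `f` is of order `l ^ a` (or smaller) as `l → 0⁺`. -/
abbrev IsOrder {E : Type*} [Norm E] (a : ℤ) (f : ℝ → E) : Prop :=
  f =O[𝓝[>] 0] fun l : ℝ => l ^ a

lemma eventually_pos : ∀ᶠ l : ℝ in 𝓝[>] 0, 0 < l := self_mem_nhdsWithin

lemma isBigO_zpow_of_le {a b : ℤ} (h : b ≤ a) :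
    (fun l : ℝ => l ^ a) =O[𝓝[>] 0] fun l : ℝ => l ^ b := by
  refine IsBigO.of_bound 1 ?_
  filter_upwards [eventually_pos, Ioo_mem_nhdsGT (zero_lt_one' ℝ)] with l h0 h1
  rw [one_mul, Real.norm_of_nonneg (zpow_nonneg h0.le _), Real.norm_of_nonneg (zpow_nonneg h0.le _)]
  exact zpow_le_zpow_right_of_le_one₀ h0 h1.2.le h

lemma isLittleO_zpow_of_lt {a b : ℤ} (h : b < a) :
    (fun l : ℝ => l ^ a) =o[𝓝[>] 0] fun l : ℝ => l ^ b := by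
  have h1 : (fun l : ℝ => l ^ b * l) =o[𝓝[>] 0] fun l : ℝ => l ^ b * (1 : ℝ) := by
    refine (isBigO_refl _ _).mul_isLittleO ((isLittleO_one_iff ℝ).mpr ?_)
    exact tendsto_id.mono_left nhdsWithin_le_nhds
  refine IsBigO.trans_isLittleO (isBigO_zpow_of_le (show b + 1 ≤ a by omega)) ?_
  refine h1.congr' ?_ (by simp)
  filter_upwards [eventually_pos] with l hl
  rw [zpow_add_one₀ hl.ne']

namespace IsOrder

variable {E : Type*} [NormedAddCommGroup E] {a b c : ℤ}

lemma mono {f : ℝ → E} (hf : IsOrder a f) (h : b ≤ a) : IsOrder b f :=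
  IsBigO.trans hf (isBigO_zpow_of_le h)

lemma mul {f g : ℝ → ℂ} (hf : IsOrder a f) (hg : IsOrder b g) (h : c ≤ a + b) :
    IsOrder c fun l => f l * g l := by
  refine (IsBigO.trans_eventuallyEq (IsBigO.mul hf hg) ?_).trans (isBigO_zpow_of_le h)
  filter_upwards [eventually_pos] with l hl
  rw [zpow_add₀ hl.ne']

lemma of_eq_zero {f : ℝ → E} (hf : ∀ l, f l = 0) : IsOrder a f :=
  IsBigO.of_bound 0 (Eventually.of_forall fun l => by simp [hf])

lemma add {f g : ℝ → E} (hf : IsOrder a f) (hg : IsOrder b g) (ha : c ≤ a) (hb : c ≤ b) :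
    IsOrder c fun l => f l + g l :=
  IsBigO.add (hf.mono ha) (hg.mono hb)

lemma const_mul {f : ℝ → ℂ} (hf : IsOrder a f) (z : ℂ) : IsOrder a fun l => z * f l :=
  IsBigO.const_mul_left hf z

lemma mdot {v w : ℝ → FourVec} (hv : IsOrder a v) (hw : IsOrder b w) (h : c ≤ a + b) :
    IsOrder c fun l => mdot (v l) (w l) := by
  have h1 : (fun l => _root_.mdot (v l) (w l)) =O[𝓝[>] 0] fun l => ‖v l‖ * ‖w l‖ :=
    IsBigO.of_bound 4 (Eventually.of_forall fun l => by
      simpa [Real.norm_of_nonneg] using norm_mdot_le (v l) (w l))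
  refine (IsBigO.trans_eventuallyEq (h1.trans (IsBigO.mul hv.norm_left hw.norm_left)) ?_).trans
    (isBigO_zpow_of_le h)
  filter_upwards [eventually_pos] with l hl
  rw [zpow_add₀ hl.ne']

lemma smul {f : ℝ → ℂ} {v : ℝ → FourVec} (hf : IsOrder a f) (hv : IsOrder b v) (h : c ≤ a + b) :
    IsOrder c fun l => f l • v l := by
  refine (IsBigO.trans_eventuallyEq (IsBigO.smul hf hv) ?_).trans (isBigO_zpow_of_le h)
  filter_upwards [eventually_pos] with l hl
  rw [zpow_add₀ hl.ne', smul_eq_mul]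

lemma inv {f : ℝ → ℂ} (hf : (fun l : ℝ => l ^ a) =O[𝓝[>] 0] f) :
    IsOrder (-a) fun l => (f l)⁻¹ := by
  have := IsBigO.inv_rev hf (by
    filter_upwards [eventually_pos] with l hl h0
    exact absurd h0 (zpow_ne_zero _ hl.ne'))
  simpa only [IsOrder, zpow_neg] using this

/-- If all the factors agree at leading power, so do the products. The bound on the second product
is part of the induction. -/
lemma prod_sub_prod {ι : Type*} (s : Finset ι) (f g : ι → ℝ → ℂ) (w : ι → ℤ)
    (hf : ∀ i ∈ s, IsOrder (w i) (f i))
    (hfg : ∀ i ∈ s, IsOrder (w i + 1) fun l => f i l - g i l) :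
    IsOrder (∑ i ∈ s, w i) (fun l => ∏ i ∈ s, g i l) ∧
      IsOrder (∑ i ∈ s, w i + 1) fun l => ∏ i ∈ s, f i l - ∏ i ∈ s, g i l := by
  classical
  induction s using Finset.induction_on with
  | empty => exact ⟨IsBigO.of_bound 1 (by simp), of_eq_zero fun l => by simp⟩
  | insert i s hi ih =>
    obtain ⟨ih1, ih2⟩ := ih (fun j hj => hf j (Finset.mem_insert_of_mem hj))
      (fun j hj => hfg j (Finset.mem_insert_of_mem hj))
    have h1 := hf i (Finset.mem_insert_self i s)
    have h2 := hfg i (Finset.mem_insert_self i s)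
    have hg : IsOrder (w i) (g i) := by
      have := IsBigO.sub h1 (h2.mono (show w i ≤ w i + 1 by omega))
      simpa using! this
    simp only [Finset.prod_insert hi, Finset.sum_insert hi]
    refine ⟨hg.mul ih1 le_rfl, ?_⟩
    have := IsBigO.add (h1.mul ih2 (show w i + ∑ j ∈ s, w j + 1 ≤ _ by omega))
      (h2.mul ih1 (show w i + ∑ j ∈ s, w j + 1 ≤ _ by omega))
    refine this.congr_left fun l => ?_
    ring

end IsOrder

/-- A correction of higher order does not spoil a lower bound. -/
lemma zpow_isBigO_of_sub {a : ℤ} {f g : ℝ → ℂ} (hf : (fun l : ℝ => l ^ a) =O[𝓝[>] 0] f)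
    (hfg : IsOrder (a + 1) fun l => f l - g l) : (fun l : ℝ => l ^ a) =O[𝓝[>] 0] g := by
  have h : (fun l => g l - f l) =o[𝓝[>] 0] f := by
    refine IsLittleO.trans_isBigO ?_ hf
    refine IsBigO.trans_isLittleO ?_ (isLittleO_zpow_of_lt (show a < a + 1 by omega))
    exact (IsBigO.neg_left hfg).congr_left fun l => by simp
  refine hf.trans ?_
  have := h.right_isBigO_add
  simpa using this

lemma eventually_ne_zero_of_zpow {a : ℤ} {f : ℝ → ℂ}
    (hf : (fun l : ℝ => l ^ a) =O[𝓝[>] 0] f) : ∀ᶠ l in 𝓝[>] (0 : ℝ), f l ≠ 0 := by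
  obtain ⟨c, hc⟩ := hf.bound
  filter_upwards [hc, eventually_pos] with l h hl h0
  rw [h0, norm_zero, mul_zero, norm_le_zero_iff] at h
  exact zpow_ne_zero _ hl.ne' h

/-- Spinor products are square roots of momentum products: `|⟨κρ⟩|² = 2 κ·ρ`. -/
lemma isOrder_ang {a b : ℤ} {κ ρ : ℝ → Spinor} (h : b = 2 * a)
    (hκ : IsOrder b fun l => mdot (mom (κ l)) (mom (ρ l))) :
    IsOrder a fun l => ang (κ l) (ρ l) := by
  subst h
  refine IsBigO.of_pow (n := 2) two_ne_zero ?_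
  refine IsBigO.trans (IsBigO.of_bound 2 (Eventually.of_forall fun l => ?_)) (hκ.congr_right ?_)
    (g := fun l => mdot (mom (κ l)) (mom (ρ l)))
  · simp only [Pi.pow_apply]
    rw [mdot_mom, Complex.norm_of_nonneg (by positivity), norm_pow]
    linarith
  · intro l
    rw [Pi.pow_apply, mul_comm, zpow_mul]; rfl

lemma isOrder_spinor {κ : ℝ → Spinor} (h : IsOrder 0 fun l => mom (κ l)) : IsOrder 0 κ := by
  refine IsBigO.of_norm_left (IsBigO.of_pow (n := 2) two_ne_zero ?_)
  refine IsBigO.trans (IsBigO.of_bound 2 (Eventually.of_forall fun l => ?_)) (h.congr_right ?_)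
    (g := fun l => mom (κ l))
  · simp only [Pi.pow_apply]
    rw [Real.norm_of_nonneg (by positivity)]
    exact norm_sq_le_norm_mom _
  · intro l
    simp

lemma isOrder_bispinorVec {κ ρ : ℝ → Spinor} (hκ : IsOrder 0 κ) (hρ : IsOrder 0 ρ) :
    IsOrder 0 fun l => bispinorVec (κ l) (ρ l) := by
  refine IsBigO.trans (g := fun l => ‖κ l‖ * ‖ρ l‖) (IsBigO.of_bound 1
    (Eventually.of_forall fun l => ?_)) ?_
  · rw [one_mul, Real.norm_of_nonneg (by positivity)]
    exact norm_bispinorVec_le _ _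
  · simpa using IsBigO.mul hκ.norm_left hρ.norm_left

lemma isOrder_ang_zero {κ ρ : ℝ → Spinor} (hκ : IsOrder 0 κ) (hρ : IsOrder 0 ρ) :
    IsOrder 0 fun l => ang (κ l) (ρ l) := by
  refine IsBigO.trans (g := fun l => ‖κ l‖ * ‖ρ l‖) (IsBigO.of_bound 2
    (Eventually.of_forall fun l => ?_)) ?_
  · rw [Real.norm_of_nonneg (by positivity)]
    exact norm_ang_le _ _
  · simpa using IsBigO.mul hκ.norm_left hρ.norm_left

/-! ### Collinear vectors -/

/-- The upper bounds of the collinear scaling `(l², 1, l)`; unlike `CollinearScaling`, they are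
stable under sums. -/
structure IsCollinear (u : ℝ → Fin 3 → ℝ) (v : ℝ → FourVec) : Prop where
  small : IsOrder 2 fun l => mdot (lightVec (u l)) (v l)
  large : IsOrder 0 fun l => mdot (lightVec (-u l)) (v l)
  perp : IsOrder 1 fun l => perpPart (u l) (v l)

lemma LegKinematics.CollinearScaling.isCollinear {u : ℝ → Fin 3 → ℝ} {v : ℝ → FourVec}
    (h : LegKinematics.CollinearScaling u v) : IsCollinear u v where
  small := h.1.trans (by simpa using! isBigO_refl _ _)
  large := h.2.1.1.trans (by simpa using! isBigO_refl (fun _ : ℝ => (1:ℝ)) _)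
  perp := h.2.2.trans (by simpa using! isBigO_refl _ _)

lemma isOrder_lightVec {u : ℝ → Fin 3 → ℝ} (hu : ∀ l, ∑ i, u l i ^ 2 = 1) :
    IsOrder 0 fun l => lightVec (u l) :=
  IsBigO.of_bound 1 (Eventually.of_forall fun l => by
    simpa using norm_lightVec_le _ (hu l))

namespace IsCollinear

variable {u : ℝ → Fin 3 → ℝ} {v w : ℝ → FourVec}

lemma zero : IsCollinear u (fun _ => 0) where
  small := IsOrder.of_eq_zero fun l => by simp [mdot_zero_right]
  large := IsOrder.of_eq_zero fun l => by simp [mdot_zero_right]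
  perp := IsOrder.of_eq_zero fun l => by simp [perpPart, mdot_zero_right]

lemma add (hv : IsCollinear u v) (hw : IsCollinear u w) :
    IsCollinear u (fun l => v l + w l) where
  small := by simpa only [mdot_add_right] using IsBigO.add hv.small hw.small
  large := by simpa only [mdot_add_right] using IsBigO.add hv.large hw.large
  perp := (IsBigO.add hv.perp hw.perp).congr_left fun l => by
    simp only [perpPart, mdot_add_right, add_div, add_smul]; abel

lemma sum {ι : Type*} (A : Finset ι) {f : ι → ℝ → FourVec} (h : ∀ i ∈ A, IsCollinear u (f i)) :
    IsCollinear u (fun l => ∑ i ∈ A, f i l) := by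
  classical
  induction A using Finset.induction_on with
  | empty => simpa using zero
  | insert i s hi ih =>
    simp only [Finset.sum_insert hi]
    exact (h i (Finset.mem_insert_self i s)).add
      (ih fun j hj => h j (Finset.mem_insert_of_mem hj))

lemma isOrder (hu : ∀ l, ∑ i, u l i ^ 2 = 1) (hv : IsCollinear u v) : IsOrder 0 v := by
  have h1 := (hv.small.const_mul (1 / 2)).smul
    (isOrder_lightVec (u := fun l => -u l) fun l => sum_neg_sq _ (hu l)) (show (0 : ℤ) ≤ _ by simp)
  have h2 := (hv.large.const_mul (1 / 2)).smul (isOrder_lightVec hu) (show (0 : ℤ) ≤ _ by simp)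
  refine (IsBigO.add (IsBigO.add (hv.perp.mono (show (0 : ℤ) ≤ 1 by simp)) h1) h2).congr_left
    fun l => ?_
  simp only [perpPart, div_eq_mul_one_div (_root_.mdot _ _), mul_comm (1 / 2 : ℂ)]
  abel

/-- At leading power a collinear vector acts as `½ (n̄·v) n`. -/
lemma mdot_sub (hu : ∀ l, ∑ i, u l i ^ 2 = 1) (hv : IsCollinear u v) {b : ℤ} (hw : IsOrder b w) :
    IsOrder (b + 1) fun l =>
      2 * mdot (v l) (w l) - mdot (lightVec (-u l)) (v l) * mdot (lightVec (u l)) (w l) := by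
  have h1 := hv.small.mul ((isOrder_lightVec (u := fun l => -u l)
    fun l => sum_neg_sq _ (hu l)).mdot hw le_rfl) (show b + 1 ≤ _ by omega)
  have h2 := (hv.perp.mdot hw (show b + 1 ≤ _ by omega)).const_mul 2
  refine (IsBigO.add h1 h2).congr_left fun l => ?_
  rw [mdot_eq_lightCone (u l) (v l) (w l)]
  ring

lemma mdot (hu : ∀ l, ∑ i, u l i ^ 2 = 1) (hv : IsCollinear u v) (hw : IsCollinear u w) :
    IsOrder 2 fun l => mdot (v l) (w l) := by
  have h1 := (hv.large.const_mul (1 / 2)).mul hw.small (show (2 : ℤ) ≤ _ by simp)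
  have h2 := (hv.small.const_mul (1 / 2)).mul hw.large (show (2 : ℤ) ≤ _ by simp)
  have h3 := hv.perp.mdot hw.perp (show (2 : ℤ) ≤ _ by simp)
  refine (IsBigO.add (IsBigO.add h1 h2) h3).congr_left fun l => ?_
  rw [mdot_eq_lightCone (u l) (v l) (w l), mdot_perpPart _ (hu l)]
  ring

end IsCollinear

noncomputable section

/-! ### Invariants of partial sums of momenta -/

/-- For momenta of nonnegative energy all the contributions to an invariant mass are nonnegative,
so each of them bounds it from below. -/
lemma norm_mdot_le_norm_sq {ι : Type*} (κ₀ : Spinor) (κ : ι → Spinor) (X : Finset ι) {a : ι}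
    (ha : a ∈ X) : ‖mdot (mom κ₀) (mom (κ a))‖ ≤
      ‖mdot (mom κ₀ + ∑ b ∈ X, mom (κ b)) (mom κ₀ + ∑ b ∈ X, mom (κ b))‖ := by
  have e : mdot (mom κ₀ + ∑ b ∈ X, mom (κ b)) (mom κ₀ + ∑ b ∈ X, mom (κ b)) =
      ((2 * ∑ b ∈ X, ‖ang κ₀ (κ b)‖ ^ 2 / 2 +
        ∑ b ∈ X, ∑ c ∈ X, ‖ang (κ b) (κ c)‖ ^ 2 / 2 : ℝ) : ℂ) := by
    rw [mdot_add_left, mdot_add_right, mdot_add_right, mdot_mom_self,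
      mdot_comm (∑ b ∈ X, mom (κ b)) (mom κ₀), mdot_sum_left]
    simp only [mdot_sum_right, mdot_mom]
    push_cast
    ring
  have hn : ∀ κ ρ : Spinor, 0 ≤ ‖ang κ ρ‖ ^ 2 / 2 := fun κ ρ => by positivity
  have h1 := Finset.single_le_sum (f := fun b => ‖ang κ₀ (κ b)‖ ^ 2 / 2)
    (fun b _ => hn κ₀ (κ b)) ha
  have h2 := Finset.sum_nonneg fun b (_ : b ∈ X) =>
    Finset.sum_nonneg fun c (_ : c ∈ X) => hn (κ b) (κ c)
  have h0 := hn κ₀ (κ a)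
  rw [e, mdot_mom, Complex.norm_of_nonneg h0]
  refine le_trans ?_ (Complex.re_le_norm _)
  rw [Complex.ofReal_re]
  linarith

namespace LegKinematics

variable {C S : Type*} (K : LegKinematics C S)

/-- The total momentum of the scalar and of the collinear photons in `A`. -/
def collMom (A : Finset C) (l : ℝ) : FourVec := K.p l + ∑ c ∈ A, K.k l (Sum.inl c)

/-- The total momentum of the soft photons in `B`. -/
def softMom (B : Finset S) (l : ℝ) : FourVec := ∑ s ∈ B, K.k l (Sum.inr s)

/-- The large component `n̄·P` of the collinear momentum. -/
def largeComp (A : Finset C) (l : ℝ) : ℂ := mdot (lightVec (-K.dir l)) (K.collMom A l)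

/-- The eikonal approximation `P² + (n̄·P)(n·k)` of the invariant mass of a line of collinear
momentum `P` and soft momentum `k`. -/
def eikonalDen (A : Finset C) (B : Finset S) (l : ℝ) : ℂ :=
  mdot (K.collMom A l) (K.collMom A l) + K.largeComp A l * mdot (K.n l) (K.softMom B l)

variable {K}

namespace InRegion

variable (hK : K.InRegion)
include hK

lemma isCollinear_collMom (A : Finset C) : IsCollinear K.dir (K.collMom A) :=
  hK.scalar_collinear.isCollinear.add
    (IsCollinear.sum A fun c _ => (hK.photon_collinear c).isCollinear)

lemma isOrder_softMom (B : Finset S) : IsOrder 2 (K.softMom B) :=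
  IsBigO.fun_sum fun s _ => hK.photon_soft s

/-- The scalar is hard enough for its products with the soft momenta to be of order `l²`. -/
lemma zpow_isBigO_scalar_dot (a : C ⊕ S) :
    (fun l : ℝ => l ^ (2 : ℤ)) =O[𝓝[>] 0] fun l => mdot (K.p l) (K.k l a) := by
  rcases a with c | s
  · exact (hK.dot_collinear c).2
  · have h1 : (fun l : ℝ => l ^ (2 : ℤ)) =O[𝓝[>] 0] fun l =>
        mdot (lightVec (-K.dir l)) (K.p l) * mdot (K.n l) (K.k l (Sum.inr s)) := by
      have := IsBigO.mul hK.scalar_collinear.2.1.2 (hK.soft_not_collinear s).2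
      simpa using! this
    have h2 := hK.scalar_collinear.isCollinear.mdot_sub hK.dir_unit
      (show IsOrder 2 fun l => K.k l (Sum.inr s) from hK.photon_soft s)
    have h3 := zpow_isBigO_of_sub h1 (g := fun l => 2 * mdot (K.p l) (K.k l (Sum.inr s)))
      ((IsBigO.neg_left h2).congr_left fun l => by simp [LegKinematics.n])
    exact h3.trans (IsBigO.const_mul_left (isBigO_refl _ _) 2)

/-- No cancellation occurs in the propagators. -/
lemma zpow_isBigO_invariant (A : Finset C) (B : Finset S) (hne : A.Nonempty ∨ B.Nonempty) :
    (fun l : ℝ => l ^ (2 : ℤ)) =O[𝓝[>] 0] fun l =>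
      mdot (K.collMom A l + K.softMom B l) (K.collMom A l + K.softMom B l) := by
  obtain ⟨a, ha⟩ : ∃ a, a ∈ A.disjSum B := by
    rcases hne with ⟨c, hc⟩ | ⟨s, hs⟩
    · exact ⟨Sum.inl c, by simpa⟩
    · exact ⟨Sum.inr s, by simpa⟩
  refine (hK.zpow_isBigO_scalar_dot a).trans (IsBigO.of_bound 1 (Eventually.of_forall fun l => ?_))
  have h := norm_mdot_le_norm_sq (K.scalar l) (fun b => K.photon b l) (A.disjSum B) ha
  rw [Finset.sum_disjSum, ← add_assoc] at h
  rw [one_mul]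
  exact h

lemma isOrder_invariant_sub (A : Finset C) (B : Finset S) :
    IsOrder (2 + 1) fun l =>
      mdot (K.collMom A l + K.softMom B l) (K.collMom A l + K.softMom B l) -
        K.eikonalDen A B l := by
  have h1 := (hK.isCollinear_collMom A).mdot_sub hK.dir_unit (hK.isOrder_softMom B)
  have h2 := (hK.isOrder_softMom B).mdot (hK.isOrder_softMom B) (show (2 + 1 : ℤ) ≤ _ by simp)
  refine (IsBigO.add h1 h2).congr_left fun l => ?_
  rw [mdot_add_left, mdot_add_right, mdot_add_right, mdot_comm (K.softMom B l) (K.collMom A l)]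
  simp only [eikonalDen, largeComp, LegKinematics.n]
  ring

lemma zpow_isBigO_eikonalDen (A : Finset C) (B : Finset S) (hne : A.Nonempty ∨ B.Nonempty) :
    (fun l : ℝ => l ^ (2 : ℤ)) =O[𝓝[>] 0] K.eikonalDen A B :=
  zpow_isBigO_of_sub (hK.zpow_isBigO_invariant A B hne) (hK.isOrder_invariant_sub A B)

/-- The propagators agree with their eikonal approximations at leading power. -/
lemma isOrder_inv_invariant_sub (A : Finset C) (B : Finset S) (hne : A.Nonempty ∨ B.Nonempty) :
    IsOrder (-2 + 1) fun l =>
      (mdot (K.collMom A l + K.softMom B l) (K.collMom A l + K.softMom B l))⁻¹ -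
        (K.eikonalDen A B l)⁻¹ := by
  have h1 := IsOrder.inv (hK.zpow_isBigO_invariant A B hne)
  have h2 := IsOrder.inv (hK.zpow_isBigO_eikonalDen A B hne)
  have h3 := ((h1.mul h2 (show (-4 : ℤ) ≤ _ by simp)).mul (hK.isOrder_invariant_sub A B)
    (show (-2 + 1 : ℤ) ≤ _ by simp)).const_mul (-1)
  refine IsBigO.congr' h3 ?_ EventuallyEq.rfl
  filter_upwards [eventually_ne_zero_of_zpow (hK.zpow_isBigO_invariant A B hne),
    eventually_ne_zero_of_zpow (hK.zpow_isBigO_eikonalDen A B hne)] with l h1 h2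
  field_simp
  ring

lemma eventually_softDot_ne_zero (s : S) :
    ∀ᶠ l in 𝓝[>] (0 : ℝ), mdot (K.n l) (K.k l (Sum.inr s)) ≠ 0 :=
  eventually_ne_zero_of_zpow (a := 2) (hK.soft_not_collinear s).2

/-! ### Polarization vectors -/

lemma isOrder_photon (c : C) : IsOrder 0 (K.photon (Sum.inl c)) :=
  isOrder_spinor ((hK.photon_collinear c).isCollinear.isOrder hK.dir_unit)

lemma isOrder_ref (c : C) : IsOrder 0 (K.ref (Sum.inl c)) :=
  isOrder_spinor ((hK.ref_collinear c).congr_right fun l => (zpow_zero l).symm)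

lemma isOrder_inv_ang (c : C) :
    IsOrder 0 fun l => (ang (K.ref (Sum.inl c) l) (K.photon (Sum.inl c) l))⁻¹ := by
  have h : (fun l : ℝ => l ^ (0 : ℤ)) =O[𝓝[>] 0]
      fun l => ang (K.ref (Sum.inl c) l) (K.photon (Sum.inl c) l) ^ 2 := by
    have h1 : (fun l : ℝ => l ^ (0 : ℤ)) =O[𝓝[>] 0] fun l =>
        mdot (mom (K.ref (Sum.inl c) l)) (K.k l (Sum.inl c)) := by
      simpa using! (hK.ref_generic c).2
    refine h1.trans (IsBigO.of_bound 1 (Eventually.of_forall fun l => ?_))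
    rw [LegKinematics.k, mdot_mom, Complex.norm_of_nonneg (by positivity), norm_pow]
    nlinarith [sq_nonneg ‖ang (K.ref (Sum.inl c) l) (K.photon (Sum.inl c) l)‖]
  have h2 := IsOrder.inv h
  refine IsBigO.of_pow (n := 2) two_ne_zero ?_
  refine (h2.congr_left fun l => ?_).congr_right fun l => ?_
  · simp
  · simp

/-- The polarization vector of a collinear photon is a bispinor times a normalization `√2 / [qr]` or
`√2 / ⟨rq⟩`, which is of order one because the reference vector is generic. -/
lemma exists_polVec_eq (c : C) : ∃ z : ℝ → ℂ, IsOrder 0 z ∧ ∀ l, K.pol l (Sum.inl c) = z l •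
    (match K.hel (Sum.inl c) with
      | .minus => bispinorVec (K.photon (Sum.inl c) l) (K.ref (Sum.inl c) l)
      | .plus => bispinorVec (K.ref (Sum.inl c) l) (K.photon (Sum.inl c) l)) := by
  have h := (hK.isOrder_inv_ang c).const_mul (Real.sqrt 2 : ℂ)
  cases hh : K.hel (Sum.inl c) with
  | plus =>
    refine ⟨_, h, fun l => ?_⟩
    simp only [LegKinematics.pol, hh, polVec, div_eq_mul_inv]
  | minus =>
    refine ⟨fun l => (Real.sqrt 2 : ℂ) / sqr (K.photon (Sum.inl c) l) (K.ref (Sum.inl c) l),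
      ?_, fun l => ?_⟩
    · refine IsBigO.of_norm_left (h.norm_left.congr_left fun l => ?_)
      rw [sqr, norm_div, norm_mul, norm_inv, RCLike.norm_conj, div_eq_mul_inv]
    · simp only [LegKinematics.pol, hh, polVec]

lemma isOrder_pol (a : C ⊕ S) : IsOrder 0 fun l => K.pol l a := by
  rcases a with c | s
  · obtain ⟨z, hz, h⟩ := hK.exists_polVec_eq c
    simp only [h]
    refine hz.smul (b := 0) ?_ (by simp)
    cases K.hel (Sum.inl c) with
    | plus => exact isOrder_bispinorVec (hK.isOrder_ref c) (hK.isOrder_photon c)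
    | minus => exact isOrder_bispinorVec (hK.isOrder_photon c) (hK.isOrder_ref c)
  · exact (hK.pol_soft s).congr_right fun l => (zpow_zero l).symm

/-- The polarization vectors of collinear photons are orthogonal to collinear momenta up to order
`l`, because `κ·ε` contains the small product `⟨κq⟩` or its conjugate. -/
lemma isOrder_mom_dot_pol (κ : ℝ → Spinor) (hκ : IsCollinear K.dir fun l => mom (κ l)) (c : C) :
    IsOrder 1 fun l => mdot (mom (κ l)) (K.pol l (Sum.inl c)) := by
  obtain ⟨z, hz, h⟩ := hK.exists_polVec_eq c
  simp only [h, mdot_smul_right]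
  refine hz.mul (b := 1) ?_ (by simp)
  have h1 : IsOrder 1 fun l => ang (κ l) (K.photon (Sum.inl c) l) :=
    isOrder_ang (b := 2) (by simp) (hκ.mdot hK.dir_unit (hK.photon_collinear c).isCollinear)
  have h2 : IsOrder 0 fun l => ang (κ l) (K.ref (Sum.inl c) l) :=
    isOrder_ang_zero (isOrder_spinor (hκ.isOrder hK.dir_unit)) (hK.isOrder_ref c)
  have h3 := (h2.mul h1 (show (1 : ℤ) ≤ _ by simp)).const_mul (1 / 2)
  cases K.hel (Sum.inl c) <;>
  · refine IsBigO.of_norm_left ((IsBigO.norm_left h3).congr_left fun l => ?_)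
    simp only [mom, mdot_bispinorVec, norm_mul, norm_div, RCLike.norm_conj]
    simp; ring

lemma isOrder_collMom_dot_pol (A : Finset C) (c : C) :
    IsOrder 1 fun l => mdot (K.collMom A l) (K.pol l (Sum.inl c)) := by
  simp only [collMom, mdot_add_left, mdot_sum_left]
  exact IsBigO.add (hK.isOrder_mom_dot_pol K.scalar hK.scalar_collinear.isCollinear c)
    (IsBigO.fun_sum fun c' _ =>
      hK.isOrder_mom_dot_pol (K.photon (Sum.inl c')) (hK.photon_collinear c').isCollinear c)

/-- Collinear photons of equal helicity have `ε·ε' ∝ ⟨qq'⟩` (or its conjugate), which is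
suppressed. -/
lemma isOrder_pol_dot_pol (c c' : C) (h : K.hel (Sum.inl c) = K.hel (Sum.inl c')) :
    IsOrder 1 fun l => mdot (K.pol l (Sum.inl c)) (K.pol l (Sum.inl c')) := by
  obtain ⟨z, hz, e⟩ := hK.exists_polVec_eq c
  obtain ⟨z', hz', e'⟩ := hK.exists_polVec_eq c'
  simp only [e, e', mdot_smul_right, mdot_smul_left]
  refine hz'.mul (b := 1) (hz.mul (b := 1) ?_ (by simp)) (by simp)
  have h1 : IsOrder 1 fun l => ang (K.photon (Sum.inl c) l) (K.photon (Sum.inl c') l) :=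
    isOrder_ang (b := 2) (by simp)
      ((hK.photon_collinear c).isCollinear.mdot hK.dir_unit (hK.photon_collinear c').isCollinear)
  have h2 : IsOrder 0 fun l => ang (K.ref (Sum.inl c) l) (K.ref (Sum.inl c') l) :=
    isOrder_ang_zero (hK.isOrder_ref c) (hK.isOrder_ref c')
  rw [← h]
  have h3 := (h2.mul h1 (show (1 : ℤ) ≤ _ by simp)).const_mul (1 / 2)
  cases K.hel (Sum.inl c) <;>
  · refine IsBigO.of_norm_left ((IsBigO.norm_left h3).congr_left fun l => ?_)
    simp only [mdot_bispinorVec, norm_mul, norm_div, RCLike.norm_conj]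
    simp; ring

end InRegion

end LegKinematics

/-! ### Vertices of a diagram -/

namespace LegDiagram

section General

variable {α : Type*} [Fintype α] (D : LegDiagram α)

lemma mem_photonsAt {i : Fin D.numVertices} {a : α} : a ∈ D.photonsAt i ↔ D.vertex a = i := by
  simp [photonsAt]

lemma photonsAt_nonempty (i : Fin D.numVertices) : (D.photonsAt i).Nonempty := by
  obtain ⟨a, ha⟩ := D.surj i
  exact ⟨a, D.mem_photonsAt.mpr ha⟩

lemma vertexFactor_of_eq_singleton (g : ℝ) (p : FourVec) (k ε : α → FourVec)
    {i : Fin D.numVertices} {a : α} (h : D.photonsAt i = {a}) :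
    D.vertexFactor g p k ε i =
      -(g : ℂ) * mdot (D.momAfter p k i + D.momBefore p k i) (ε a) := by
  simp [vertexFactor, h]

lemma vertexFactor_of_card_ne_one [DecidableEq α] (g : ℝ) (p : FourVec) (k ε : α → FourVec)
    {i : Fin D.numVertices} (h : (D.photonsAt i).card ≠ 1) :
    D.vertexFactor g p k ε i =
      ∑ ab ∈ (D.photonsAt i).offDiag, -(g : ℂ) ^ 2 * mdot (ε ab.1) (ε ab.2) := by
  unfold vertexFactor
  rw [if_neg h]

lemma isOrder_vertexFactor_of_card_ne_one (g : ℝ) (p : ℝ → FourVec) (k ε : ℝ → α → FourVec)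
    {i : Fin D.numVertices} (h : (D.photonsAt i).card ≠ 1) {w : ℤ}
    (hε : ∀ a ∈ D.photonsAt i, ∀ b ∈ D.photonsAt i, IsOrder w fun l => mdot (ε l a) (ε l b)) :
    IsOrder w fun l => D.vertexFactor g (p l) (k l) (ε l) i := by
  classical
  simp only [D.vertexFactor_of_card_ne_one g _ _ _ h]
  refine IsBigO.fun_sum fun ab hab => ?_
  rw [Finset.mem_offDiag] at hab
  exact (hε _ hab.1 _ hab.2.1).const_mul _

end General

variable {C S : Type*}

/-! ### Diagrams with a given collinear topology -/

/-- The label of a photon: collinear photons are labelled by their vertex in `T`, soft photons by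
themselves. -/
def label (T : LegDiagram C) : C ⊕ S → Fin T.numVertices ⊕ S := Sum.map T.vertex id

lemma label_surjective (T : LegDiagram C) : Function.Surjective (T.label (S := S)) := by
  rintro (t | s)
  · obtain ⟨c, hc⟩ := T.surj t
    exact ⟨Sum.inl c, by simp [label, hc]⟩
  · exact ⟨Sum.inr s, rfl⟩

/-- `h` places the vertices of `T` and the soft photons at the vertices of `D`, in a way that
makes `D` a diagram with the collinear topology `T`. -/
structure IsPlacement (D : LegDiagram (C ⊕ S)) (T : LegDiagram C)
    (h : Fin T.numVertices ⊕ S → Fin D.numVertices) : Prop where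
  vertex_eq : ∀ a, D.vertex a = h (T.label a)
  lt_of_lt : ∀ t t', t < t' → h (Sum.inl t) < h (Sum.inl t')

lemma HasTopology.exists_isPlacement {D : LegDiagram (C ⊕ S)} {T : LegDiagram C}
    (hD : D.HasTopology T) : ∃ h, D.IsPlacement T h := by
  choose c hc using T.surj
  refine ⟨Sum.elim (fun t => D.vertex (Sum.inl (c t))) fun s => D.vertex (Sum.inr s), ?_, ?_⟩
  · rintro (a | s)
    · simp only [label, Sum.map_inl, Sum.elim_inl]
      exact le_antisymm ((hD _ _).mpr (hc _).ge) ((hD _ _).mpr (hc _).le)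
    · rfl
  · intro t t' htt'
    simp only [Sum.elim_inl]
    rw [← not_le, hD, hc, hc, not_le]
    exact htt'

namespace IsPlacement

variable {D : LegDiagram (C ⊕ S)} {T : LegDiagram C}
  {h : Fin T.numVertices ⊕ S → Fin D.numVertices} (H : D.IsPlacement T h)
include H

lemma le_iff_le (t t' : Fin T.numVertices) : h (Sum.inl t) ≤ h (Sum.inl t') ↔ t ≤ t' :=
  StrictMono.le_iff_le (f := fun t => h (Sum.inl t)) fun t t' => H.lt_of_lt t t'

lemma lt_iff_lt (t t' : Fin T.numVertices) : h (Sum.inl t) < h (Sum.inl t') ↔ t < t' :=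
  StrictMono.lt_iff_lt (f := fun t => h (Sum.inl t)) fun t t' => H.lt_of_lt t t'

lemma hasTopology : D.HasTopology T := fun c c' => by
  rw [H.vertex_eq, H.vertex_eq]
  exact H.le_iff_le _ _

lemma surjective : Function.Surjective h := fun i => by
  obtain ⟨a, ha⟩ := D.surj i
  exact ⟨T.label a, by rw [← H.vertex_eq, ha]⟩

end IsPlacement

section Labels

variable (T : LegDiagram C)

open Classical in
/-- The collinear photons whose label lies in `B`. -/
def collIn [Fintype C] (B : Finset (Fin T.numVertices ⊕ S)) : Finset C :=
  Finset.univ.filter fun c => Sum.inl (T.vertex c) ∈ B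

open Classical in
/-- The soft photons in the set of labels `B`. -/
def softIn [Fintype S] {T : LegDiagram C} (B : Finset (Fin T.numVertices ⊕ S)) : Finset S :=
  Finset.univ.filter fun s => Sum.inr s ∈ B

lemma mem_collIn [Fintype C] {B : Finset (Fin T.numVertices ⊕ S)} {c : C} :
    c ∈ T.collIn B ↔ Sum.inl (T.vertex c) ∈ B := by
  simp [collIn]

lemma mem_softIn [Fintype S] {B : Finset (Fin T.numVertices ⊕ S)} {s : S} :
    s ∈ softIn B ↔ Sum.inr s ∈ B := by
  simp [softIn]

lemma collIn_or_softIn_nonempty [Fintype C] [Fintype S]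
    {B : Finset (Fin T.numVertices ⊕ S)} (hB : B.Nonempty) :
    (T.collIn B).Nonempty ∨ (softIn B).Nonempty := by
  obtain ⟨t | s, hv⟩ := hB
  · obtain ⟨c, rfl⟩ := T.surj t
    exact Or.inl ⟨c, T.mem_collIn.mpr hv⟩
  · exact Or.inr ⟨s, T.mem_softIn.mpr hv⟩

/-- The number of powers of `1 / l` that the vertex `t` of `T`, or a soft photon, contributes
together with the adjacent propagator. -/
def weight [Fintype C] (K : LegKinematics C S) : Fin T.numVertices ⊕ S → ℤ
  | Sum.inl t => (((T.photonsAt t).image fun c => K.hel (Sum.inl c)).card : ℤ)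
  | Sum.inr _ => 2

lemma sum_weight [Fintype C] [Fintype S] (K : LegKinematics C S) :
    ∑ v, T.weight K v = (K.collinearOrder T : ℤ) + 2 * (Fintype.card S : ℤ) := by
  simp [Fintype.sum_sum_type, weight, LegKinematics.collinearOrder, mul_comm]

lemma sum_fiber_weight [Fintype C] [Fintype S] (K : LegKinematics C S) {n : ℕ}
    (h : Fin T.numVertices ⊕ S → Fin n) :
    ∑ i, -(∑ u with h u = i, T.weight K u) =
      -(K.collinearOrder T : ℤ) - 2 * (Fintype.card S : ℤ) := by
  rw [Finset.sum_neg_distrib, Finset.sum_fiberwise, T.sum_weight]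
  ring

lemma one_le_weight [Fintype C] (K : LegKinematics C S) (v : Fin T.numVertices ⊕ S) :
    1 ≤ T.weight K v := by
  rcases v with t | s
  · simp only [weight]
    exact_mod_cast Finset.card_pos.mpr ((T.photonsAt_nonempty t).image _)
  · simp [weight]

variable [Fintype C] (K : LegKinematics C S) (g : ℝ)

/-- The eikonal vertex factor for the label `v`: the vertex factor of `T` for a vertex of `T`, and
`-g (n̄·P)(n·ε)` for a soft photon, where `B` is the set of labels up to and including `v`. -/
def eikonalNum (v : Fin T.numVertices ⊕ S) (B : Finset (Fin T.numVertices ⊕ S)) (l : ℝ) : ℂ :=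
  match v with
  | Sum.inl t => T.vertexFactor g (K.p l) (fun c => K.k l (Sum.inl c))
      (fun c => K.pol l (Sum.inl c)) t
  | Sum.inr s => -(g : ℂ) * (K.largeComp (T.collIn B) l * mdot (K.n l) (K.pol l (Sum.inr s)))

/-- The eikonal factor of a vertex and the propagator next to it. -/
def eikonalFactor [Fintype S] (v : Fin T.numVertices ⊕ S)
    (B : Finset (Fin T.numVertices ⊕ S)) (l : ℝ) : ℂ :=
  T.eikonalNum K g v B l * (K.eikonalDen (T.collIn B) (softIn B) l)⁻¹

lemma momAfter_coll (t : Fin T.numVertices) (l : ℝ) :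
    T.momAfter (K.p l) (fun c => K.k l (Sum.inl c)) t =
      K.collMom (Finset.univ.filter fun c => T.vertex c ≤ t) l := by
  simp only [momAfter, LegKinematics.collMom]

lemma momBefore_coll (t : Fin T.numVertices) (l : ℝ) :
    T.momBefore (K.p l) (fun c => K.k l (Sum.inl c)) t =
      K.collMom (Finset.univ.filter fun c => T.vertex c < t) l := by
  simp only [momBefore, LegKinematics.collMom]

end Labels

namespace IsPlacement

variable [Fintype C] [Fintype S] {D : LegDiagram (C ⊕ S)} {T : LegDiagram C}
  {h : Fin T.numVertices ⊕ S → Fin D.numVertices} (H : D.IsPlacement T h)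
include H

lemma momAfter_eq (K : LegKinematics C S) (i : Fin D.numVertices) (l : ℝ) :
    D.momAfter (K.p l) (K.k l) i =
      K.collMom (T.collIn (Finset.univ.filter fun v => h v ≤ i)) l +
        K.softMom (softIn (Finset.univ.filter fun v => h v ≤ i)) l := by
  classical
  simp only [momAfter, LegKinematics.collMom, LegKinematics.softMom, add_assoc]
  congr 1
  rw [Finset.sum_filter, Fintype.sum_sum_type, ← Finset.sum_filter, ← Finset.sum_filter]
  congr 1 <;> refine Finset.sum_congr ?_ fun _ _ => rfl <;> ext <;>
    simp [collIn, softIn, H.vertex_eq, label]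

lemma momBefore_eq (K : LegKinematics C S) (i : Fin D.numVertices) (l : ℝ) :
    D.momBefore (K.p l) (K.k l) i =
      K.collMom (T.collIn (Finset.univ.filter fun v => h v < i)) l +
        K.softMom (softIn (Finset.univ.filter fun v => h v < i)) l := by
  classical
  simp only [momBefore, LegKinematics.collMom, LegKinematics.softMom, add_assoc]
  congr 1
  rw [Finset.sum_filter, Fintype.sum_sum_type, ← Finset.sum_filter, ← Finset.sum_filter]
  congr 1 <;> refine Finset.sum_congr ?_ fun _ _ => rfl <;> ext <;>
    simp [collIn, softIn, H.vertex_eq, label]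

lemma mem_photonsAt_iff {i : Fin D.numVertices} {a : C ⊕ S} :
    a ∈ D.photonsAt i ↔ h (T.label a) = i := by
  rw [D.mem_photonsAt, H.vertex_eq]

lemma collIn_le (t : Fin T.numVertices) :
    T.collIn (Finset.univ.filter fun v => h v ≤ h (Sum.inl t)) =
      Finset.univ.filter fun c => T.vertex c ≤ t := by
  ext c; simp [mem_collIn, H.le_iff_le]

lemma collIn_lt (t : Fin T.numVertices) :
    T.collIn (Finset.univ.filter fun v => h v < h (Sum.inl t)) =
      Finset.univ.filter fun c => T.vertex c < t := by
  ext c; simp [mem_collIn, H.lt_iff_lt]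

end IsPlacement

end LegDiagram

/-! ### Power counting for vertices -/

namespace LegKinematics.InRegion

open LegDiagram

variable {C S : Type*} [Fintype C] {K : LegKinematics C S} (hK : K.InRegion)
  {T : LegDiagram C} (g : ℝ)
include hK

/-- The power counting for the vertices of `T`. -/
lemma isOrder_vertexFactor (t : Fin T.numVertices) :
    IsOrder (2 - T.weight K (Sum.inl t)) fun l => T.vertexFactor g (K.p l)
      (fun c => K.k l (Sum.inl c)) (fun c => K.pol l (Sum.inl c)) t := by
  have hw := T.one_le_weight K (Sum.inl t)
  by_cases h1 : (T.photonsAt t).card = 1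
  · obtain ⟨c, hc⟩ := Finset.card_eq_one.mp h1
    simp only [T.vertexFactor_of_eq_singleton g _ _ _ hc, momAfter_coll, momBefore_coll,
      mdot_add_left]
    exact ((hK.isOrder_collMom_dot_pol _ c).add (hK.isOrder_collMom_dot_pol _ c)
      (by omega) (by omega)).const_mul _
  · by_cases h2 : T.weight K (Sum.inl t) = 1
    · refine T.isOrder_vertexFactor_of_card_ne_one g _ _ (fun l c => K.pol l (Sum.inl c)) h1
        fun c hc c' hc' => (hK.isOrder_pol_dot_pol c c' ?_).mono (by omega)
      have h3 : ((T.photonsAt t).image fun c => K.hel (Sum.inl c)).card ≤ 1 := by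
        simp only [weight] at h2
        exact_mod_cast h2.le
      exact Finset.card_le_one.mp h3 _ (Finset.mem_image_of_mem _ hc) _
        (Finset.mem_image_of_mem _ hc')
    · exact T.isOrder_vertexFactor_of_card_ne_one g _ _ (fun l c => K.pol l (Sum.inl c)) h1
        fun c _ c' _ => (hK.isOrder_pol _).mdot (hK.isOrder_pol _) (by omega)

lemma isOrder_eikonalNum (v : Fin T.numVertices ⊕ S) (B : Finset (Fin T.numVertices ⊕ S)) :
    IsOrder (2 - T.weight K v) fun l => T.eikonalNum K g v B l := by
  rcases v with t | s
  · exact hK.isOrder_vertexFactor g t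
  · exact ((hK.isCollinear_collMom _).large.mul ((isOrder_lightVec hK.dir_unit).mdot
      (hK.isOrder_pol (Sum.inr s)) le_rfl) (by simp [weight])).const_mul _

variable [Fintype S] {D : LegDiagram (C ⊕ S)}
  {h : Fin T.numVertices ⊕ S → Fin D.numVertices} (H : D.IsPlacement T h)
include H

/-- A vertex factor of `D` at which only the label `v` is placed has the eikonal form at leading
power. -/
lemma isOrder_vertexFactor_sub_of_fiber (v : Fin T.numVertices ⊕ S)
    (hv : ∀ w, h w = h v → w = v) :
    IsOrder (2 - T.weight K v + 1) fun l => D.vertexFactor g (K.p l) (K.k l) (K.pol l) (h v) -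
      T.eikonalNum K g v (Finset.univ.filter fun w => h w ≤ h v) l := by
  classical
  have hsoft : ∀ (B : Finset S) (a : C ⊕ S),
      IsOrder 2 fun l => mdot (K.softMom B l) (K.pol l a) := fun B a =>
    (hK.isOrder_softMom B).mdot (hK.isOrder_pol a) (by simp)
  rcases v with t | s
  · have hw := T.one_le_weight K (Sum.inl t)
    have hphot : D.photonsAt (h (Sum.inl t)) =
        (T.photonsAt t).map (Function.Embedding.inl (β := S)) := by
      ext a
      rw [H.mem_photonsAt_iff]
      constructor
      · intro ha
        have := hv _ ha
        rcases a with c | s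
        · simpa [label, T.mem_photonsAt] using this
        · simp [label] at this
      · intro ha
        obtain ⟨c, hc, rfl⟩ := Finset.mem_map.mp ha
        rw [T.mem_photonsAt] at hc
        simp [label, hc]
    by_cases h1 : (T.photonsAt t).card = 1
    · obtain ⟨c, hc⟩ := Finset.card_eq_one.mp h1
      rw [hc, Finset.map_singleton] at hphot
      have e : ∀ l, D.vertexFactor g (K.p l) (K.k l) (K.pol l) (h (Sum.inl t)) -
          T.eikonalNum K g (Sum.inl t) (Finset.univ.filter fun w => h w ≤ h (Sum.inl t)) l =
          -(g : ℂ) * (mdot (K.softMom (softIn (Finset.univ.filter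
              fun w => h w ≤ h (Sum.inl t))) l) (K.pol l (Sum.inl c)) +
            mdot (K.softMom (softIn (Finset.univ.filter
              fun w => h w < h (Sum.inl t))) l) (K.pol l (Sum.inl c))) := by
        intro l
        rw [D.vertexFactor_of_eq_singleton g _ _ _ hphot, eikonalNum,
          T.vertexFactor_of_eq_singleton g _ _ _ hc, momAfter_coll, momBefore_coll,
          H.momAfter_eq, H.momBefore_eq, H.collIn_le, H.collIn_lt]
        simp only [mdot_add_left, Function.Embedding.inl_apply]
        ring
      simp only [e]
      exact ((hsoft _ _).add (hsoft _ _) (by omega) (by omega)).const_mul _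
    · have h1' : (D.photonsAt (h (Sum.inl t))).card ≠ 1 := by rwa [hphot, Finset.card_map]
      refine IsOrder.of_eq_zero fun l => ?_
      have hoff : (D.photonsAt (h (Sum.inl t))).offDiag = (T.photonsAt t).offDiag.map
          ((Function.Embedding.inl (β := S)).prodMap Function.Embedding.inl) := by
        rw [hphot]
        ext ⟨a, b⟩
        rcases a with a | a <;> rcases b with b | b <;> simp
      rw [eikonalNum, D.vertexFactor_of_card_ne_one g _ _ _ h1',
        T.vertexFactor_of_card_ne_one g _ _ _ h1, hoff, Finset.sum_map, sub_eq_zero]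
      rfl
  · have hphot : D.photonsAt (h (Sum.inr s)) = {Sum.inr s} := by
      ext a
      rw [H.mem_photonsAt_iff, Finset.mem_singleton]
      constructor
      · intro ha
        have := hv _ ha
        rcases a with c | s <;> simp_all [label]
      · rintro rfl
        rfl
    have hlt : T.collIn (Finset.univ.filter fun w => h w < h (Sum.inr s)) =
        T.collIn (Finset.univ.filter fun w => h w ≤ h (Sum.inr s)) := by
      ext c
      simp only [mem_collIn, Finset.mem_filter, Finset.mem_univ, true_and]
      refine ⟨le_of_lt, fun hc => lt_of_le_of_ne hc fun hc' => ?_⟩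
      exact absurd (hv _ hc') (by simp)
    have h1 := (hK.isCollinear_collMom (T.collIn (Finset.univ.filter
      fun w => h w ≤ h (Sum.inr s)))).mdot_sub hK.dir_unit (hK.isOrder_pol (Sum.inr s))
    have h2 := (hsoft (softIn (Finset.univ.filter fun w => h w ≤ h (Sum.inr s))) (Sum.inr s)).add
      (hsoft (softIn (Finset.univ.filter fun w => h w < h (Sum.inr s))) (Sum.inr s))
      (show (0 + 1 : ℤ) ≤ 2 by simp) (by simp)
    refine (((h1.add h2 le_rfl le_rfl).const_mul (-(g : ℂ))).mono
      (by simp [weight])).congr_left fun l => ?_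
    rw [D.vertexFactor_of_eq_singleton g _ _ _ hphot, H.momAfter_eq, H.momBefore_eq, hlt]
    simp only [mdot_add_left, eikonalNum, LegKinematics.largeComp, LegKinematics.n]
    ring

/-- The vertex of a single label, together with its propagator, agrees with the eikonal factor at
leading power. -/
lemma isOrder_factor_sub_of_fiber (v : Fin T.numVertices ⊕ S) (hv : ∀ w, h w = h v → w = v) :
    IsOrder (-T.weight K v) (fun l => D.vertexFactor g (K.p l) (K.k l) (K.pol l) (h v) /
        mdot (D.momAfter (K.p l) (K.k l) (h v)) (D.momAfter (K.p l) (K.k l) (h v))) ∧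
      IsOrder (-T.weight K v + 1) fun l =>
        D.vertexFactor g (K.p l) (K.k l) (K.pol l) (h v) /
          mdot (D.momAfter (K.p l) (K.k l) (h v)) (D.momAfter (K.p l) (K.k l) (h v)) -
        T.eikonalFactor K g v (Finset.univ.filter fun w => h w ≤ h v) l := by
  set B := Finset.univ.filter fun w => h w ≤ h v with hB
  have hne := T.collIn_or_softIn_nonempty (B := B) ⟨v, by simp [hB]⟩
  have hnum := hK.isOrder_eikonalNum g v B
  have hsub := hK.isOrder_vertexFactor_sub_of_fiber g H v hv
  rw [← hB] at hsub
  have hinv := IsOrder.inv (hK.zpow_isBigO_invariant _ _ hne)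
  have hinvsub := hK.isOrder_inv_invariant_sub _ _ hne
  have hmom := fun l => H.momAfter_eq K (h v) l
  rw [← hB] at hmom
  simp only [hmom]
  constructor
  · have := (IsBigO.add hnum (hsub.mono (show 2 - T.weight K v ≤ _ by omega)))
    refine (IsOrder.mul this hinv (show -T.weight K v ≤ _ by omega)).congr_left fun l => ?_
    rw [div_eq_mul_inv]; congr 1; ring
  · refine (IsBigO.add (hsub.mul hinv (show -T.weight K v + 1 ≤ _ by omega))
      (hnum.mul hinvsub (show -T.weight K v + 1 ≤ _ by omega))).congr_left fun l => ?_
    rw [eikonalFactor, div_eq_mul_inv]; ring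

/-- A vertex that a soft photon shares with another photon is suppressed. -/
lemma isOrder_factor_of_ne {v w : Fin T.numVertices ⊕ S} (hvw : v ≠ w) (he : h v = h w) :
    IsOrder (-(∑ u with h u = h v, T.weight K u) + 1) fun l =>
      D.vertexFactor g (K.p l) (K.k l) (K.pol l) (h v) /
        mdot (D.momAfter (K.p l) (K.k l) (h v)) (D.momAfter (K.p l) (K.k l) (h v)) := by
  classical
  have hweight : 3 ≤ ∑ u with h u = h v, T.weight K u := by
    have h1 : ∑ u ∈ {v, w}, T.weight K u ≤ ∑ u with h u = h v, T.weight K u := by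
      refine Finset.sum_le_sum_of_subset_of_nonneg ?_ fun u _ _ =>
        (zero_le_one.trans (T.one_le_weight K u))
      intro u hu
      simp only [Finset.mem_insert, Finset.mem_singleton] at hu
      rcases hu with rfl | rfl <;> simp [he]
    rw [Finset.sum_pair hvw] at h1
    have hv1 := T.one_le_weight K v
    have hw1 := T.one_le_weight K w
    -- Two vertices of `T` are never at the same place, so one of the labels is soft.
    have h2 : T.weight K v = 2 ∨ T.weight K w = 2 := by
      rcases v with t | s
      · rcases w with t' | s'
        · exfalso
          apply hvw
          rw [le_antisymm ((H.le_iff_le t t').mp he.le) ((H.le_iff_le t' t).mp he.ge)]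
        · exact Or.inr rfl
      · exact Or.inl rfl
    omega
  have hcard : (D.photonsAt (h v)).card ≠ 1 := by
    obtain ⟨a, ha⟩ := T.label_surjective v
    obtain ⟨b, hb⟩ := T.label_surjective w
    intro h1
    have := Finset.card_le_one.mp h1.le a (by rw [H.mem_photonsAt_iff, ha]) b
      (by rw [H.mem_photonsAt_iff, hb, he])
    exact hvw (by rw [← ha, ← hb, this])
  have hnum : IsOrder 0 fun l => D.vertexFactor g (K.p l) (K.k l) (K.pol l) (h v) :=
    D.isOrder_vertexFactor_of_card_ne_one g _ _ _ hcard
      fun a _ b _ => (hK.isOrder_pol a).mdot (hK.isOrder_pol b) (by simp)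
  have hne := T.collIn_or_softIn_nonempty (B := Finset.univ.filter fun w => h w ≤ h v)
    ⟨v, by simp⟩
  simp only [H.momAfter_eq K, div_eq_mul_inv]
  exact hnum.mul (IsOrder.inv (hK.zpow_isBigO_invariant _ _ hne)) (by omega)

/-- A vertex with the propagator next to it is never larger than the labels at it would be at
separate vertices. -/
lemma isOrder_factor (i : Fin D.numVertices) :
    IsOrder (-(∑ u with h u = i, T.weight K u)) fun l =>
      D.vertexFactor g (K.p l) (K.k l) (K.pol l) i /
        mdot (D.momAfter (K.p l) (K.k l) i) (D.momAfter (K.p l) (K.k l) i) := by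
  classical
  obtain ⟨v, rfl⟩ := H.surjective i
  by_cases hv : ∀ w, h w = h v → w = v
  · have e : (Finset.univ.filter fun w => h w = h v) = {v} := by
      ext w
      simpa using ⟨hv w, fun hw => by rw [hw]⟩
    rw [e, Finset.sum_singleton]
    exact (hK.isOrder_factor_sub_of_fiber g H v hv).1
  · push Not at hv
    obtain ⟨w, hw, hne⟩ := hv
    exact (hK.isOrder_factor_of_ne g H hne.symm hw.symm).mono (by omega)

/-- Diagrams in which a soft photon shares a vertex with another photon are suppressed. -/
lemma isOrder_amplitude_of_not_injective (hh : ¬ Function.Injective h) :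
    IsOrder (-(K.collinearOrder T : ℤ) - 2 * (Fintype.card S : ℤ) + 1) fun l =>
      D.amplitude g (K.p l) (K.k l) (K.pol l) := by
  classical
  obtain ⟨v, w, he, hne⟩ : ∃ v w, h v = h w ∧ v ≠ w := by
    simpa only [Function.Injective, not_forall, exists_prop] using hh
  have key := (IsOrder.prod_sub_prod Finset.univ
    (fun i l => D.vertexFactor g (K.p l) (K.k l) (K.pol l) i /
      mdot (D.momAfter (K.p l) (K.k l) i) (D.momAfter (K.p l) (K.k l) i))
    (fun i l => if i = h v then 0 else D.vertexFactor g (K.p l) (K.k l) (K.pol l) i /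
      mdot (D.momAfter (K.p l) (K.k l) i) (D.momAfter (K.p l) (K.k l) i))
    (fun i => -(∑ u with h u = i, T.weight K u))
    (fun i _ => hK.isOrder_factor g H i) (fun i _ => ?_)).2
  · rw [T.sum_fiber_weight K h] at key
    refine key.congr_left fun l => ?_
    refine (sub_eq_self.mpr ?_).trans rfl
    exact Finset.prod_eq_zero (Finset.mem_univ (h v)) (by rw [if_pos rfl])
  · by_cases hi : i = h v
    · subst hi
      simpa using hK.isOrder_factor_of_ne g H hne he
    · exact IsOrder.of_eq_zero fun l => by simp [hi]

/-- Diagrams in which every label has its own vertex agree with the product of their eikonal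
factors at leading power. -/
lemma isOrder_amplitude_sub_of_injective (hh : Function.Injective h) :
    IsOrder (-(K.collinearOrder T : ℤ) - 2 * (Fintype.card S : ℤ) + 1) fun l =>
      D.amplitude g (K.p l) (K.k l) (K.pol l) -
        ∏ v, T.eikonalFactor K g v (Finset.univ.filter fun w => h w ≤ h v) l := by
  have key := (IsOrder.prod_sub_prod Finset.univ
    (fun v l => D.vertexFactor g (K.p l) (K.k l) (K.pol l) (h v) /
      mdot (D.momAfter (K.p l) (K.k l) (h v)) (D.momAfter (K.p l) (K.k l) (h v)))
    (fun v l => T.eikonalFactor K g v (Finset.univ.filter fun w => h w ≤ h v) l)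
    (fun v => -T.weight K v)
    (fun v _ => (hK.isOrder_factor_sub_of_fiber g H v fun w hw => hh hw).1)
    (fun v _ => (hK.isOrder_factor_sub_of_fiber g H v fun w hw => hh hw).2)).2
  rw [Finset.sum_neg_distrib, T.sum_weight, neg_add'] at key
  refine key.congr_left fun l => ?_
  congr 1
  exact (Equiv.ofBijective h ⟨hh, H.surjective⟩).prod_comp fun i =>
    D.vertexFactor g (K.p l) (K.k l) (K.pol l) i /
      mdot (D.momAfter (K.p l) (K.k l) i) (D.momAfter (K.p l) (K.k l) i)

end LegKinematics.InRegion

/-! ### The eikonal identity -/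

namespace LegDiagram

variable {C S : Type*} (T : LegDiagram C)

/-- The order of the vertices of `T`, as a relation between labels. -/
def labelRel : Fin T.numVertices ⊕ S → Fin T.numVertices ⊕ S → Prop
  | Sum.inl t, Sum.inl t' => t < t'
  | _, _ => False

/-- The diagram on all photons in which each vertex carries the photons of one label, in the order
given by `e`. -/
def ofOrder {N : ℕ} (e : Fin T.numVertices ⊕ S ≃ Fin N) : LegDiagram (C ⊕ S) where
  numVertices := N
  vertex a := e (T.label a)
  surj := e.surjective.comp T.label_surjective
  card_le_two i := by
    obtain ⟨v, rfl⟩ := e.surjective i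
    simp only [EmbeddingLike.apply_eq_iff_eq]
    rcases v with t | s
    · have h : {a | T.label (S := S) a = Sum.inl t} = Sum.inl '' {c | T.vertex c = t} := by
        ext a
        rcases a with c | s <;> simp [label]
      rw [h, Set.ncard_image_of_injective _ Sum.inl_injective]
      exact T.card_le_two t
    · have h : {a | T.label (S := S) a = Sum.inr s} = {Sum.inr s} := by
        ext a
        rcases a with c | s <;> simp [label]
      rw [h, Set.ncard_singleton]
      simp

lemma ofOrder_injective {N : ℕ} :
    Function.Injective (T.ofOrder : (Fin T.numVertices ⊕ S ≃ Fin N) → LegDiagram (C ⊕ S)) := by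
  intro e e' h
  simp only [ofOrder, mk.injEq, heq_eq_eq, true_and] at h
  ext v : 1
  obtain ⟨a, rfl⟩ := T.label_surjective v
  exact congrFun h a

lemma isPlacement_ofOrder {N : ℕ} {e : Fin T.numVertices ⊕ S ≃ Fin N}
    (he : ∀ v w, T.labelRel v w → e v < e w) : (T.ofOrder e).IsPlacement T e :=
  ⟨fun _ => rfl, fun _ _ h => he _ _ h⟩

variable {T} in
lemma IsPlacement.exists_ofOrder [Fintype S] {D : LegDiagram (C ⊕ S)}
    {h : Fin T.numVertices ⊕ S → Fin D.numVertices} (H : D.IsPlacement T h)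
    (hh : Function.Injective h) :
    ∃ e : Fin T.numVertices ⊕ S ≃ Fin (Fintype.card (Fin T.numVertices ⊕ S)),
      (∀ v w, T.labelRel v w → e v < e w) ∧ T.ofOrder e = D := by
  have hs := H.surjective
  obtain ⟨N, vertex, surj, hcard⟩ := D
  have hN : N = Fintype.card (Fin T.numVertices ⊕ S) := by
    simpa using (Fintype.card_of_bijective ⟨hh, hs⟩).symm
  subst hN
  refine ⟨Equiv.ofBijective h ⟨hh, hs⟩, ?_, ?_⟩
  · rintro (t | s) (t' | s') hvw
    · exact H.lt_of_lt t t' hvw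
    all_goals exact hvw.elim
  · simp only [ofOrder, mk.injEq, heq_eq_eq, true_and]
    exact (funext H.vertex_eq).symm

variable [Fintype C] [Fintype S] (K : LegKinematics C S)

/-- The term of the eikonal denominator that belongs to the label `v`, divided by the whole
denominator. It plays the part of the probability that `v` is the last label of `B`. All vertices of
`T` get the term `P²`, since only the last of them in `B` can be the last label. -/
def lastWeight (l : ℝ) (v : Fin T.numVertices ⊕ S) (B : Finset (Fin T.numVertices ⊕ S)) : ℂ :=
  (match v with
    | Sum.inl _ => mdot (K.collMom (T.collIn B) l) (K.collMom (T.collIn B) l)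
    | Sum.inr s => K.largeComp (T.collIn B) l * mdot (K.n l) (K.k l (Sum.inr s))) /
  K.eikonalDen (T.collIn B) (softIn B) l

open Classical in
/-- The partial-fraction identity behind the factorization: the eikonal denominator is the sum of
the terms that belong to the labels which may come last. If `B` contains no vertex of `T`, this
rests on `p² = 0`. -/
lemma sum_lastWeight (l : ℝ) (B : Finset (Fin T.numVertices ⊕ S))
    (hden : K.eikonalDen (T.collIn B) (softIn B) l ≠ 0) :
    ∑ v ∈ B with ∀ w ∈ B, ¬ T.labelRel v w, T.lastWeight K l v B = 1 := by
  have hsoft : ∑ s : S, (if Sum.inr s ∈ B then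
      K.largeComp (T.collIn B) l * mdot (K.n l) (K.k l (Sum.inr s)) else 0) =
      K.largeComp (T.collIn B) l * mdot (K.n l) (K.softMom (softIn B) l) := by
    rw [← Finset.sum_filter, ← Finset.mul_sum, LegKinematics.softMom, mdot_sum_right]
    congr!
  have hcoll : ∑ t : Fin T.numVertices, (if Sum.inl t ∈ B ∧ ∀ t', Sum.inl t' ∈ B → ¬ t < t' then
      mdot (K.collMom (T.collIn B) l) (K.collMom (T.collIn B) l) else 0) =
      mdot (K.collMom (T.collIn B) l) (K.collMom (T.collIn B) l) := by
    rcases (Finset.univ.filter fun t : Fin T.numVertices => Sum.inl t ∈ B).eq_empty_or_nonempty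
      with h0 | hne
    · have h1 : ∀ t : Fin T.numVertices, (Sum.inl t : Fin T.numVertices ⊕ S) ∉ B := fun t ht =>
        Finset.notMem_empty t (h0 ▸ Finset.mem_filter.mpr ⟨Finset.mem_univ _, ht⟩)
      have h2 : T.collIn B = ∅ := by
        ext c; simp [mem_collIn, h1]
      simp [h2, LegKinematics.collMom, LegKinematics.p, mdot_mom_self]
    · obtain ⟨t, ht, hmax⟩ := Finset.exists_max_image _ id hne
      simp only [Finset.mem_filter, Finset.mem_univ, true_and, id] at ht hmax
      rw [Finset.sum_eq_single t, if_pos ⟨ht, fun t' ht' => not_lt.mpr (hmax t' ht')⟩]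
      · intro t' _ hne'
        refine if_neg fun h => h.2 t ht (lt_of_le_of_ne (hmax t' h.1) hne')
      · simp
  have hsplit : ∑ v ∈ B with ∀ w ∈ B, ¬ T.labelRel v w, T.lastWeight K l v B =
      (∑ t : Fin T.numVertices, (if Sum.inl t ∈ B ∧ ∀ t', Sum.inl t' ∈ B → ¬ t < t' then
        mdot (K.collMom (T.collIn B) l) (K.collMom (T.collIn B) l) else 0)) /
          K.eikonalDen (T.collIn B) (softIn B) l +
      (∑ s : S, (if Sum.inr s ∈ B then
        K.largeComp (T.collIn B) l * mdot (K.n l) (K.k l (Sum.inr s)) else 0)) /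
          K.eikonalDen (T.collIn B) (softIn B) l := by
    rw [Finset.sum_div, Finset.sum_div]
    rw [show (B.filter fun v => ∀ w ∈ B, ¬ T.labelRel v w) =
      Finset.univ.filter fun v => v ∈ B ∧ ∀ w ∈ B, ¬ T.labelRel v w by ext; simp]
    rw [Finset.sum_filter, Fintype.sum_sum_type]
    congr 1 <;> refine Finset.sum_congr rfl fun x _ => ?_
    · simp only [Sum.forall, labelRel, not_false_eq_true, implies_true, and_true]
      split_ifs <;> simp [lastWeight]
    · simp only [labelRel, not_false_eq_true, implies_true, and_true]
      split_ifs <;> simp [lastWeight]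
  rw [hsplit, hcoll, hsoft, ← add_div]
  exact div_self hden

end LegDiagram

namespace LegKinematics.InRegion

open LegDiagram

variable {C S : Type*} [Fintype C] [Fintype S] {K : LegKinematics C S} (hK : K.InRegion)
  (T : LegDiagram C) (g : ℝ)
include hK

open Classical in
/-- The eikonal identity: summed over all the orders in which the soft photons can be inserted
among the vertices of `T`, the eikonal factors combine to the diagram `T` times independent
emissions of the soft photons. -/
theorem eventually_sum_prod_eikonalFactor : ∀ᶠ l in 𝓝[>] (0 : ℝ),
    ∑ e : Fin T.numVertices ⊕ S ≃ Fin (Fintype.card (Fin T.numVertices ⊕ S)) with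
      ∀ v w, T.labelRel v w → e v < e w,
      ∏ v, T.eikonalFactor K g v (Finset.univ.filter fun w => e w ≤ e v) l =
    T.amplitude g (K.p l) (fun c => K.k l (Sum.inl c)) (fun c => K.pol l (Sum.inl c)) *
      ∏ s : S, (-(g : ℂ) * mdot (K.n l) (K.pol l (Sum.inr s)) /
        mdot (K.n l) (K.k l (Sum.inr s))) := by
  have hden : ∀ᶠ l in 𝓝[>] (0 : ℝ), ∀ B : Finset (Fin T.numVertices ⊕ S), B.Nonempty →
      K.eikonalDen (T.collIn B) (softIn B) l ≠ 0 := by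
    refine eventually_all.mpr fun B => ?_
    by_cases hB : B.Nonempty
    · filter_upwards [eventually_ne_zero_of_zpow (hK.zpow_isBigO_eikonalDen _ _
        (T.collIn_or_softIn_nonempty hB))] with l hl _ using hl
    · exact Eventually.of_forall fun l h => absurd h hB
  have hQ : ∀ᶠ l in 𝓝[>] (0 : ℝ), ∀ t : Fin T.numVertices,
      mdot (T.momAfter (K.p l) (fun c => K.k l (Sum.inl c)) t)
        (T.momAfter (K.p l) (fun c => K.k l (Sum.inl c)) t) ≠ 0 := by
    refine eventually_all.mpr fun t => ?_
    obtain ⟨c, hc⟩ := T.surj t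
    simp only [momAfter_coll]
    simpa [LegKinematics.softMom] using eventually_ne_zero_of_zpow (hK.zpow_isBigO_invariant
      (Finset.univ.filter fun c => T.vertex c ≤ t) (∅ : Finset S) (Or.inl ⟨c, by simp [hc]⟩))
  filter_upwards [hden, hQ, eventually_all.mpr hK.eventually_softDot_ne_zero] with l hden hQ ha
  let φ : Fin T.numVertices ⊕ S → ℂ := Sum.elim
    (fun t => T.vertexFactor g (K.p l) (fun c => K.k l (Sum.inl c))
        (fun c => K.pol l (Sum.inl c)) t /
      mdot (T.momAfter (K.p l) (fun c => K.k l (Sum.inl c)) t)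
        (T.momAfter (K.p l) (fun c => K.k l (Sum.inl c)) t))
    (fun s => -(g : ℂ) * mdot (K.n l) (K.pol l (Sum.inr s)) / mdot (K.n l) (K.k l (Sum.inr s)))
  have hφ : ∏ v, φ v =
      T.amplitude g (K.p l) (fun c => K.k l (Sum.inl c)) (fun c => K.pol l (Sum.inl c)) *
        ∏ s : S, (-(g : ℂ) * mdot (K.n l) (K.pol l (Sum.inr s)) /
          mdot (K.n l) (K.k l (Sum.inr s))) := by
    rw [Fintype.prod_sum_type]; rfl
  have hirr : ∀ v : Fin T.numVertices ⊕ S, ¬ T.labelRel v v := by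
    rintro (t | s)
    · exact lt_irrefl t
    · exact id
  have hone := sum_equiv_prod_eq_one T.labelRel hirr (T.lastWeight K l)
    (fun B hB => T.sum_lastWeight K l B (hden B hB)) _ rfl
  rw [← hφ, ← one_mul (∏ v, φ v), ← hone, Finset.sum_mul]
  refine Finset.sum_congr rfl fun e he => ?_
  have hpl := T.isPlacement_ofOrder (Finset.mem_filter.mp he).2
  rw [← Finset.prod_mul_distrib]
  refine Finset.prod_congr rfl fun v _ => ?_
  rcases v with t | s
  · have h1 : T.collIn (Finset.univ.filter fun w => e w ≤ e (Sum.inl t)) =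
        Finset.univ.filter fun c => T.vertex c ≤ t := hpl.collIn_le t
    have h2 := hQ t
    simp only [eikonalFactor, eikonalNum, lastWeight, φ, Sum.elim_inl]
    rw [momAfter_coll, ← h1] at *
    field_simp
  · have h2 := ha s
    simp only [eikonalFactor, eikonalNum, lastWeight, φ, Sum.elim_inr]
    field_simp

end LegKinematics.InRegion

end

/-! ### Factorization of the soft photons -/

theorem mainTheorem5 {C S : Type*} [Fintype C] [Fintype S] (g : ℝ) (K : LegKinematics C S)
    (hK : K.InRegion) (T : LegDiagram C) :
    ∃ Y : ℝ → ℂ,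
      (∀ᶠ l in 𝓝[>] (0 : ℝ), Tendsto
        (fun δ : ℝ => wilsonElement g δ (K.n l)
          (fun s : S => K.k l (Sum.inr s)) (fun s : S => K.pol l (Sum.inr s)))
        (𝓝[>] 0) (𝓝 (Y l))) ∧
      AgreeAtLeadingPower (-(K.collinearOrder T : ℤ) - 2 * (Fintype.card S : ℤ))
        (fun l => softAttachmentSum T g (K.p l) (K.k l) (K.pol l))
        (fun l => T.amplitude g (K.p l)
          (fun c : C => K.k l (Sum.inl c)) (fun c : C => K.pol l (Sum.inl c)) * Y l) := by
  classical
  refine ⟨fun l => ∏ s : S, (-(g : ℂ) * mdot (K.n l) (K.pol l (Sum.inr s)) /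
    mdot (K.n l) (K.k l (Sum.inr s))), ?_, ?_, ?_⟩
  · filter_upwards [eventually_all.mpr hK.eventually_softDot_ne_zero] with l hl
    choose a _ ha using fun s : S => mdot_lightVec_mom (K.dir l) (hK.dir_unit l)
      (K.photon (Sum.inr s) l)
    refine tendsto_wilsonElement g _ _ _ a ha fun s hs => hl s ?_
    exact (ha s).trans (by rw [hs, Complex.ofReal_zero])
  · have hT : ∀ t, IsOrder (-T.weight K (Sum.inl t)) fun l =>
        T.vertexFactor g (K.p l) (fun c => K.k l (Sum.inl c)) (fun c => K.pol l (Sum.inl c)) t /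
          mdot (T.momAfter (K.p l) (fun c => K.k l (Sum.inl c)) t)
            (T.momAfter (K.p l) (fun c => K.k l (Sum.inl c)) t) := fun t => by
      obtain ⟨c, hc⟩ := T.surj t
      have h := IsOrder.inv (hK.zpow_isBigO_invariant
        (Finset.univ.filter fun c => T.vertex c ≤ t) (∅ : Finset S) (Or.inl ⟨c, by simp [hc]⟩))
      simp only [LegKinematics.softMom, Finset.sum_empty, add_zero] at h
      simp only [LegDiagram.momAfter_coll, div_eq_mul_inv]
      exact (hK.isOrder_vertexFactor g t).mul h (by omega)
    have hS : ∀ s : S, IsOrder (-2) fun l => -(g : ℂ) * mdot (K.n l) (K.pol l (Sum.inr s)) /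
        mdot (K.n l) (K.k l (Sum.inr s)) := fun s => by
      have h := IsOrder.inv (a := 2) (hK.soft_not_collinear s).2
      simp only [div_eq_mul_inv]
      exact (((isOrder_lightVec hK.dir_unit).mdot (hK.isOrder_pol (Sum.inr s))
        le_rfl).const_mul _).mul h (by simp)
    have h1 := (IsOrder.prod_sub_prod Finset.univ _ _ _ (fun t _ => hT t)
      fun t _ => IsOrder.of_eq_zero fun l => sub_self _).1
    have h2 := (IsOrder.prod_sub_prod Finset.univ _ _ _ (fun s _ => hS s)
      fun s _ => IsOrder.of_eq_zero fun l => sub_self _).1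
    refine h1.mul h2 (le_of_eq ?_)
    rw [sub_eq_add_neg, Finset.sum_neg_distrib]
    simp [LegDiagram.weight, LegKinematics.collinearOrder, mul_comm]
  -- The diagrams with a vertex of its own for every label correspond to the orders `e`.
  · have hgood : IsOrder (-(K.collinearOrder T : ℤ) - 2 * (Fintype.card S : ℤ) + 1) fun l =>
        ∑ e : Fin T.numVertices ⊕ S ≃ Fin (Fintype.card (Fin T.numVertices ⊕ S)) with
          ∀ v w, T.labelRel v w → e v < e w,
          ((T.ofOrder e).amplitude g (K.p l) (K.k l) (K.pol l) -
            ∏ v, T.eikonalFactor K g v (Finset.univ.filter fun w => e w ≤ e v) l) :=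
      IsBigO.fun_sum fun e he => hK.isOrder_amplitude_sub_of_injective g
        (T.isPlacement_ofOrder (Finset.mem_filter.mp he).2) e.injective
    set good := ((Finset.univ.filter fun e : Fin T.numVertices ⊕ S ≃
      Fin (Fintype.card (Fin T.numVertices ⊕ S)) => ∀ v w, T.labelRel v w → e v < e w).image
        T.ofOrder) with hgood_def
    have hbad : IsOrder (-(K.collinearOrder T : ℤ) - 2 * (Fintype.card S : ℤ) + 1) fun l =>
        ∑ D ∈ (Finset.univ.filter fun D : LegDiagram (C ⊕ S) => D.HasTopology T) \ good,
          D.amplitude g (K.p l) (K.k l) (K.pol l) := by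
      refine IsBigO.fun_sum fun D hD => ?_
      rw [Finset.mem_sdiff, Finset.mem_filter] at hD
      obtain ⟨h, H⟩ := hD.1.2.exists_isPlacement
      refine hK.isOrder_amplitude_of_not_injective g H fun hh => hD.2 ?_
      obtain ⟨e, he, rfl⟩ := H.exists_ofOrder hh
      exact Finset.mem_image_of_mem _ (Finset.mem_filter.mpr ⟨Finset.mem_univ _, he⟩)
    have hsub : good ⊆ Finset.univ.filter fun D : LegDiagram (C ⊕ S) => D.HasTopology T := by
      intro D hD
      obtain ⟨e, he, rfl⟩ := Finset.mem_image.mp hD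
      exact Finset.mem_filter.mpr ⟨Finset.mem_univ _,
        (T.isPlacement_ofOrder (Finset.mem_filter.mp he).2).hasTopology⟩
    refine IsBigO.congr' (IsBigO.add hgood hbad) ?_ EventuallyEq.rfl
    filter_upwards [hK.eventually_sum_prod_eikonalFactor T g] with l hl
    have hsum : softAttachmentSum T g (K.p l) (K.k l) (K.pol l) =
        ∑ D ∈ (Finset.univ.filter fun D : LegDiagram (C ⊕ S) => D.HasTopology T) \ good,
          D.amplitude g (K.p l) (K.k l) (K.pol l) +
        ∑ D ∈ good, D.amplitude g (K.p l) (K.k l) (K.pol l) := by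
      rw [Finset.sum_sdiff hsub, softAttachmentSum]
    rw [hsum, hgood_def, Finset.sum_image fun e _ e' _ h => T.ofOrder_injective h, ← hl,
      Finset.sum_sub_distrib]
    ring
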